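/- Let $Q$ be a (Hausdorff) smooth Banach manifold modelled on a Banach space $E$, with a smooth weak Riemannian metric $\langle\cdot,\cdot\rangle$ (a smooth field of continuous, symmetric, positive definite bilinear forms $\langle\cdot,\cdot\rangle_\eta$ on the spaces $T_\eta Q$, which need not induce the topology of $T_\eta Q$). Assume that $Q$ has a smooth Riemannian connection, that is, in charts there are smooth symmetric bilinear Christoffel maps $\Gamma(\eta)$ with $D_\eta\langle a,b\rangle_\eta\cdot c=\langle\Gamma(\eta)(c,a),b\rangle_\eta+\langle a,\Gamma(\eta)(c,b)\rangle_\eta$, and a globally defined connector map $K:TTQ\to TQ$ with local form $K(\eta,v,u,w)=(\eta,w+\Gamma(\eta)(v,u))$. Let $\tau:TQ\to Q$ and $\tau_1:TTQ\to TQ$ be the projections and $\Theta=(\tau_1,T\tau,K):TTQ\to TQ\oplus TQ\oplus TQ$. For $f:TQ\to\mathbb R$ and $V,W\in T_\eta Q$ put $$\frac{\partial f}{\partial\eta}(V)\cdot W=df\cdot\Theta^{-1}(V,W,0),\qquad \frac{\partial f}{\partial v}(V)\cdot W=df\cdot\Theta^{-1}(V,0,W).$$ For an open set $U\subseteq TQ$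 let $\mathcal K(U)$ be the set of smooth functions $f:U\to\mathbb R$ for which these two functionals are represented through $\langle\cdot,\cdot\rangle_\eta$ by vectors of $T_\eta Q$, again denoted $\frac{\partial f}{\partial\eta}(V)$ and $\frac{\partial f}{\partial v}(V)$, that depend smoothly on $V\in U$ as maps $U\to TQ$; let $\mathcal K=\mathcal K(TQ)$. For $f,g\in\mathcal K(U)$ and $V\in U\cap T_\eta Q$ let $$\{f,g\}(V)=\Big\langle\frac{\partial f}{\partial\eta}(V),\frac{\partial g}{\partial v}(V)\Big\rangle_\eta-\Big\langle\frac{\partial f}{\partial v}(V),\frac{\partial g}{\partial\eta}(V)\Big\rangle_\eta .$$ Let $\Omega$ be the canonical weak symplectic form on $TQ$, given in charts by $$\Omega(\eta,e)((e_1,e_2),(e_3,e_4))=\langle e_1,e_4\rangle_\eta-\langle e_2,e_3\rangle_\eta+D_\eta\langle e,e_1\rangle_\eta\cdot e_3-D_\eta\langle e,e_3\rangle_\eta\cdot e_1 .$$ Let $X$ be a smooth Hamiltonian vector field on $TQ$, i.e. a smooth vector field with $\Omega(X,\cdot)=dH$ for some smooth $H:TQ\to\mathbb R$, and let $F_t$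 be a (local) flow of $X$: there is an open set $D\subseteq\mathbb R\times TQ$ such that $(t,V)\in D$ implies $(s,V)\in D$ for all $s$ between $0$ and $t$, the points $F_t(V)\in TQ$ are defined for $(t,V)\in D$, and for every $V$ the curve $t\mapsto F_t(V)$ is an integral curve of $X$ with $F_0(V)=V$. Put $D_t=\{V:(t,V)\in D\}$ (so $D_t=TQ$ for a global flow). Then $F_t$ is Poisson on $\mathcal K$: for every $t$ and all $f,g\in\mathcal K$, one has $f\circ F_t,\ g\circ F_t\in\mathcal K(D_t)$ and $$\{f\circ F_t,g\circ F_t\}=\{f,g\}\circ F_t\quad\text{on } D_t .$$ -/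

import Mathlib

open Bundle Set
open scoped Manifold ContDiff Topology

namespace WeakPoisson

noncomputable section

/-- A smooth weak Riemannian metric on the Banach manifold `Q` modelled on `E`: a smooth field of
continuous symmetric positive definite bilinear forms on the tangent spaces. The norm which the form
induces on a tangent space may be strictly weaker than the given topology. -/
structure WeakRiemannianMetric (E : Type*) [NormedAddCommGroup E] [NormedSpace ℝ E]
    (Q : Type*) [TopologicalSpace Q] [ChartedSpace E Q] [IsManifold 𝓘(ℝ, E) ∞ Q] where
  /-- the scalar product on the tangent space at `q` -/
  inner (q : Q) : TangentSpace 𝓘(ℝ, E) q →L[ℝ] TangentSpace 𝓘(ℝ, E) q →L[ℝ] ℝ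
  symm (q : Q) (v w : TangentSpace 𝓘(ℝ, E) q) : inner q v w = inner q w v
  pos (q : Q) (v : TangentSpace 𝓘(ℝ, E) q) (hv : v ≠ 0) : 0 < inner q v v
  contMDiff : ContMDiff 𝓘(ℝ, E) (𝓘(ℝ, E).prod 𝓘(ℝ, E →L[ℝ] E →L[ℝ] ℝ)) ∞
    (fun q ↦ TotalSpace.mk' (E →L[ℝ] E →L[ℝ] ℝ) q (inner q))

section Charts

variable {E : Type*} [NormedAddCommGroup E] [NormedSpace ℝ E]
  {Q : Type*} [TopologicalSpace Q] [ChartedSpace E Q] [IsManifold 𝓘(ℝ, E) ∞ Q]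

/-- The metric in the chart of `Q` around `p`: the scalar product `⟨a, b⟩_x` of the vectors
`a, b : E`, at the point with coordinate `x : E`. -/
def WeakRiemannianMetric.inChart (g : WeakRiemannianMetric E Q) (p : Q) (x a b : E) : ℝ :=
  g.inner ((extChartAt 𝓘(ℝ, E) p).symm x)
    (mfderiv 𝓘(ℝ, E) 𝓘(ℝ, E) (extChartAt 𝓘(ℝ, E) p).symm x a)
    (mfderiv 𝓘(ℝ, E) 𝓘(ℝ, E) (extChartAt 𝓘(ℝ, E) p).symm x b)

/-- The tangent map of the chart of `Q` around `p`, at `q`. -/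
def chartDeriv (p q : Q) : TangentSpace 𝓘(ℝ, E) q →L[ℝ] E :=
  mfderiv 𝓘(ℝ, E) 𝓘(ℝ, E) (extChartAt 𝓘(ℝ, E) p) q

/-- The chart `V ↦ (η, v)` of `TQ` induced by the chart of `Q` around `p`. -/
def tangentChart (p : Q) (V : TangentBundle 𝓘(ℝ, E) Q) : E × E :=
  (extChartAt 𝓘(ℝ, E) p V.proj, chartDeriv p V.proj V.2)

/-- The tangent map at `V` of the chart of `TQ` induced by the chart of `Q` around `p`. It sends a
tangent vector of `TQ` to its coordinates `(u, w)`. -/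
def tangentChartDeriv (p : Q) (V : TangentBundle 𝓘(ℝ, E) Q) :
    TangentSpace 𝓘(ℝ, E).tangent V →L[ℝ] E × E :=
  mfderiv 𝓘(ℝ, E).tangent 𝓘(ℝ, E × E) (tangentChart p) V

/-- The tangent map `Tτ` of the projection `τ : TQ → Q`, at `V`. -/
def projDeriv (V : TangentBundle 𝓘(ℝ, E) Q) :
    TangentSpace 𝓘(ℝ, E).tangent V →L[ℝ] TangentSpace 𝓘(ℝ, E) V.proj :=
  mfderiv 𝓘(ℝ, E).tangent 𝓘(ℝ, E) (fun W : TangentBundle 𝓘(ℝ, E) Q ↦ W.proj) V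

/-- The canonical weak symplectic form of `TQ`, given in the chart of `TQ` around `V` by
`Ω(η,e)((e₁,e₂),(e₃,e₄)) = ⟨e₁,e₄⟩_η - ⟨e₂,e₃⟩_η + D_η⟨e,e₁⟩_η·e₃ - D_η⟨e,e₃⟩_η·e₁`. -/
def WeakRiemannianMetric.symplecticForm (g : WeakRiemannianMetric E Q)
    (V : TangentBundle 𝓘(ℝ, E) Q) (ξ ζ : TangentSpace 𝓘(ℝ, E).tangent V) : ℝ :=
  let p : Q := V.proj
  let η : E := (tangentChart p V).1
  let e : E := (tangentChart p V).2
  let e₁ : E := (tangentChartDeriv p V ξ).1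
  let e₂ : E := (tangentChartDeriv p V ξ).2
  let e₃ : E := (tangentChartDeriv p V ζ).1
  let e₄ : E := (tangentChartDeriv p V ζ).2
  g.inChart p η e₁ e₄ - g.inChart p η e₂ e₃
    + fderiv ℝ (fun x ↦ g.inChart p x e e₁) η e₃
    - fderiv ℝ (fun x ↦ g.inChart p x e e₃) η e₁

end Charts

/-- A smooth Riemannian (symmetric and metric) connection of the weak Riemannian metric `g`, given
by its connector map `K : TTQ → TQ` and its Christoffel maps `Γ` in the charts of `Q`. -/
structure RiemannianConnection {E : Type*} [NormedAddCommGroup E] [NormedSpace ℝ E]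
    {Q : Type*} [TopologicalSpace Q] [ChartedSpace E Q] [IsManifold 𝓘(ℝ, E) ∞ Q]
    (g : WeakRiemannianMetric E Q) where
  /-- the connector map on the tangent space of `TQ` at `V` -/
  connector (V : TangentBundle 𝓘(ℝ, E) Q) :
    TangentSpace 𝓘(ℝ, E).tangent V →L[ℝ] TangentSpace 𝓘(ℝ, E) V.proj
  /-- the Christoffel map `Γ(x)(u, v)` in the chart around `p` -/
  christoffel (p : Q) : E → E →L[ℝ] E →L[ℝ] E
  contDiffOn_christoffel (p : Q) :
    ContDiffOn ℝ ∞ (christoffel p) (extChartAt 𝓘(ℝ, E) p).target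
  christoffel_symm (p : Q) (x : E) (hx : x ∈ (extChartAt 𝓘(ℝ, E) p).target) (u v : E) :
    christoffel p x u v = christoffel p x v u
  christoffel_metric (p : Q) (x : E) (hx : x ∈ (extChartAt 𝓘(ℝ, E) p).target) (a b c : E) :
    fderiv ℝ (fun y ↦ g.inChart p y a b) x c =
      g.inChart p x (christoffel p x c a) b + g.inChart p x a (christoffel p x c b)
  /-- in the chart around `p`, the connector map is `(η, v, u, w) ↦ (η, w + Γ(η)(v, u))` -/
  connector_inChart (p : Q) (V : TangentBundle 𝓘(ℝ, E) Q)
    (hV : V.proj ∈ (extChartAt 𝓘(ℝ, E) p).source) (ξ : TangentSpace 𝓘(ℝ, E).tangent V) :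
    chartDeriv p V.proj (connector V ξ) =
      (tangentChartDeriv p V ξ).2 +
        christoffel p (tangentChart p V).1 (tangentChart p V).2 (tangentChartDeriv p V ξ).1

section Bracket

variable {E : Type*} [NormedAddCommGroup E] [NormedSpace ℝ E]
  {Q : Type*} [TopologicalSpace Q] [ChartedSpace E Q] [IsManifold 𝓘(ℝ, E) ∞ Q]
  {g : WeakRiemannianMetric E Q}

/-- The map `Θ = (τ₁, Tτ, K)` on the tangent space of `TQ` at `V`. It is a linear homeomorphism. -/
def RiemannianConnection.theta (c : RiemannianConnection g) (V : TangentBundle 𝓘(ℝ, E) Q) :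
    TangentSpace 𝓘(ℝ, E).tangent V →L[ℝ]
      TangentSpace 𝓘(ℝ, E) V.proj × TangentSpace 𝓘(ℝ, E) V.proj :=
  (projDeriv V).prod (c.connector V)

/-- The covariant partial derivative `∂f/∂η (V) · W = df · Θ⁻¹(V, W, 0)`. -/
def RiemannianConnection.partialBase (c : RiemannianConnection g)
    (f : TangentBundle 𝓘(ℝ, E) Q → ℝ) (V : TangentBundle 𝓘(ℝ, E) Q)
    (W : TangentSpace 𝓘(ℝ, E) V.proj) : ℝ :=
  mfderiv 𝓘(ℝ, E).tangent 𝓘(ℝ, ℝ) f V ((c.theta V).inverse (W, 0))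

/-- The covariant partial derivative `∂f/∂v (V) · W = df · Θ⁻¹(V, 0, W)`. -/
def RiemannianConnection.partialFiber (c : RiemannianConnection g)
    (f : TangentBundle 𝓘(ℝ, E) Q → ℝ) (V : TangentBundle 𝓘(ℝ, E) Q)
    (W : TangentSpace 𝓘(ℝ, E) V.proj) : ℝ :=
  mfderiv 𝓘(ℝ, E).tangent 𝓘(ℝ, ℝ) f V ((c.theta V).inverse (0, W))

/-- `Z` represents the functional `φ` on the tangent space at `q`: `φ(W) = ⟨Z, W⟩_q` for all `W`.
Such a `Z` is unique, but need not exist. -/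
def WeakRiemannianMetric.Represents (g : WeakRiemannianMetric E Q) (q : Q)
    (φ : TangentSpace 𝓘(ℝ, E) q → ℝ) (Z : TangentSpace 𝓘(ℝ, E) q) : Prop :=
  ∀ W : TangentSpace 𝓘(ℝ, E) q, φ W = g.inner q Z W

open Classical in
/-- The vector that represents `φ` if there is one, and `0` otherwise. -/
def WeakRiemannianMetric.representative (g : WeakRiemannianMetric E Q) (q : Q)
    (φ : TangentSpace 𝓘(ℝ, E) q → ℝ) : TangentSpace 𝓘(ℝ, E) q :=
  if h : ∃ Z, g.Represents q φ Z then h.choose else 0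

/-- `∂f/∂η (V)` as an element of the tangent space of `Q`. -/
def RiemannianConnection.gradBase (c : RiemannianConnection g)
    (f : TangentBundle 𝓘(ℝ, E) Q → ℝ) (V : TangentBundle 𝓘(ℝ, E) Q) :
    TangentSpace 𝓘(ℝ, E) V.proj :=
  g.representative V.proj (c.partialBase f V)

/-- `∂f/∂v (V)` as an element of the tangent space of `Q`. -/
def RiemannianConnection.gradFiber (c : RiemannianConnection g)
    (f : TangentBundle 𝓘(ℝ, E) Q → ℝ) (V : TangentBundle 𝓘(ℝ, E) Q) :
    TangentSpace 𝓘(ℝ, E) V.proj :=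
  g.representative V.proj (c.partialFiber f V)

/-- The class `𝒦(U)`, for an open subset `U` of `TQ`: the smooth functions on `U` whose covariant
partial derivatives are represented by tangent vectors of `Q`, which define smooth maps
`U → TQ`. For `U = TQ` this is the class `𝒦`. -/
structure RiemannianConnection.IsClassK (c : RiemannianConnection g)
    (U : Set (TangentBundle 𝓘(ℝ, E) Q)) (f : TangentBundle 𝓘(ℝ, E) Q → ℝ) : Prop where
  smooth : ContMDiffOn 𝓘(ℝ, E).tangent 𝓘(ℝ, ℝ) ∞ f U
  exists_base : ∀ V ∈ U, ∃ Z, g.Represents V.proj (c.partialBase f V) Z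
  exists_fiber : ∀ V ∈ U, ∃ Z, g.Represents V.proj (c.partialFiber f V) Z
  smooth_base : ContMDiffOn 𝓘(ℝ, E).tangent 𝓘(ℝ, E).tangent ∞
    (fun V ↦ (⟨V.proj, c.gradBase f V⟩ : TangentBundle 𝓘(ℝ, E) Q)) U
  smooth_fiber : ContMDiffOn 𝓘(ℝ, E).tangent 𝓘(ℝ, E).tangent ∞
    (fun V ↦ (⟨V.proj, c.gradFiber f V⟩ : TangentBundle 𝓘(ℝ, E) Q)) U

/-- The Poisson bracket `{f, h} = ⟨∂f/∂η, ∂h/∂v⟩ - ⟨∂f/∂v, ∂h/∂η⟩`. -/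
def RiemannianConnection.bracket (c : RiemannianConnection g)
    (f h : TangentBundle 𝓘(ℝ, E) Q → ℝ) (V : TangentBundle 𝓘(ℝ, E) Q) : ℝ :=
  g.inner V.proj (c.gradBase f V) (c.gradFiber h V)
    - g.inner V.proj (c.gradFiber f V) (c.gradBase h V)

/-- `X` is a smooth Hamiltonian vector field on `TQ`: a smooth vector field for which there is a
smooth function `H` on `TQ` with `Ω(X, ·) = dH`. -/
def WeakRiemannianMetric.IsSmoothHamiltonian (g : WeakRiemannianMetric E Q)
    (X : (V : TangentBundle 𝓘(ℝ, E) Q) → TangentSpace 𝓘(ℝ, E).tangent V) : Prop :=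
  ContMDiff 𝓘(ℝ, E).tangent 𝓘(ℝ, E).tangent.tangent ∞
    (fun V ↦ (⟨V, X V⟩ : TangentBundle 𝓘(ℝ, E).tangent (TangentBundle 𝓘(ℝ, E) Q))) ∧
  ∃ H : TangentBundle 𝓘(ℝ, E) Q → ℝ, ContMDiff 𝓘(ℝ, E).tangent 𝓘(ℝ, ℝ) ∞ H ∧
    ∀ (V : TangentBundle 𝓘(ℝ, E) Q) (ξ : TangentSpace 𝓘(ℝ, E).tangent V),
      g.symplecticForm V (X V) ξ = mfderiv 𝓘(ℝ, E).tangent 𝓘(ℝ, ℝ) H V ξ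

/-- `F` is a (local) flow of the vector field `X`, with `F t V` defined for `(t, V)` in the open set
`D`: with `(t, V)` the set `D` contains `(s, V)` for all `s` between `0` and `t`, and for every `V`
the curve `t ↦ F t V` is an integral curve of `X` that starts at `V`. A global flow is the case
`D = univ`; flow boxes and maximal flows are other cases. -/
structure IsLocalFlow
    (X : (V : TangentBundle 𝓘(ℝ, E) Q) → TangentSpace 𝓘(ℝ, E).tangent V)
    (D : Set (ℝ × TangentBundle 𝓘(ℝ, E) Q))
    (F : ℝ → TangentBundle 𝓘(ℝ, E) Q → TangentBundle 𝓘(ℝ, E) Q) : Prop where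
  isOpen : IsOpen D
  uIcc_mem : ∀ (t : ℝ) (V : TangentBundle 𝓘(ℝ, E) Q), (t, V) ∈ D → ∀ s ∈ uIcc 0 t, (s, V) ∈ D
  map_zero : ∀ V : TangentBundle 𝓘(ℝ, E) Q, ((0 : ℝ), V) ∈ D → F 0 V = V
  integralCurve : ∀ V : TangentBundle 𝓘(ℝ, E) Q,
    IsMIntegralCurveOn (I := 𝓘(ℝ, E).tangent) (fun t ↦ F t V) X {t : ℝ | (t, V) ∈ D}

end Bracket

end

end WeakPoisson

/-! The connection splits each tangent space of `TQ` into horizontal and vertical vectors, and in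
this splitting the symplectic form reads `Ω(ξ, ζ) = ⟨Tτ ξ, K ζ⟩ - ⟨K ξ, Tτ ζ⟩`
(`RiemannianConnection.symplecticForm_eq`). Hence `∂f/∂v` and `-∂f/∂η` are the two components of a
vector `Y_f` with `Ω(Y_f, ·) = df`. On an open set, class `𝒦` means that `f` is smooth and has a
smooth Hamiltonian vector field, and `{f, h} = Ω(Y_f, Y_h)`.

If a map `φ` is smooth, has invertible derivative and preserves `Ω`, then the pull-back of `Y_f` by
`φ` is a smooth Hamiltonian vector field of `f ∘ φ`. So `f ∘ φ` is again of class `𝒦`, and brackets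
are carried to brackets. It remains to see that `F t` is such a map (`IsLocalFlow.isSymplecticAt`).
Invertibility must be carried along: as `Ω` is only weakly nondegenerate, its invariance yields
injectivity of the derivative but not surjectivity.

In a chart `Ω = -dθ` for the canonical one-form `θ`. Since the contraction of `Ω` with `X` is exact,
the Lie derivative of `Ω` along `X` vanishes, and short-time flows preserve `Ω`
(`negExtDeriv_flow_eq`). Their regularity in the initial value follows from Picard–Lindelöf by
induction through the variational equation (`hasContDiffFlows`). Uniqueness of integral curves
identifies `F` locally with these flows, and a connectedness argument in time reaches every `t`
(`isSymplecticAt_flow`). -/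

/-! ### Smooth dependence of local flows on the initial value -/

/-! ### Grönwall estimates and differentiability of a flow in the initial value. -/

section Gronwall

variable {P : Type*} [NormedAddCommGroup P] [NormedSpace ℝ P]

/-- Grönwall's inequality on an interval with one end at `0`, to either side. -/
theorem norm_le_gronwallBound_abs {y y' : ℝ → P} {K δ : ℝ} {t : ℝ}
    (hy : ∀ s ∈ uIcc 0 t, HasDerivAt y (y' s) s)
    (bound : ∀ s ∈ uIcc 0 t, ‖y' s‖ ≤ K * ‖y s‖ + δ) :
    ‖y t‖ ≤ gronwallBound ‖y 0‖ K δ |t| := by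
  rcases le_total 0 t with ht | ht
  · rw [uIcc_of_le ht] at hy bound
    have := norm_le_gronwallBound_of_norm_deriv_right_le (f := y) (f' := y') (a := 0) (b := t)
      (fun s hs ↦ (hy s hs).continuousAt.continuousWithinAt)
      (fun s hs ↦ (hy s (Ico_subset_Icc_self hs)).hasDerivWithinAt) le_rfl
      (fun s hs ↦ bound s (Ico_subset_Icc_self hs)) t (right_mem_Icc.2 ht)
    simpa [abs_of_nonneg ht] using this
  · rw [uIcc_of_ge ht] at hy bound
    have hmem : ∀ s ∈ Icc 0 (-t), -s ∈ Icc t 0 := fun s hs ↦ ⟨by linarith [hs.2], by linarith [hs.1]⟩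
    have hd : ∀ s ∈ Icc 0 (-t), HasDerivAt (fun s ↦ y (-s)) (-(y' (-s))) s := fun s hs ↦ by
      simpa [Function.comp_def] using (hy (-s) (hmem s hs)).scomp s (hasDerivAt_neg s)
    have := norm_le_gronwallBound_of_norm_deriv_right_le (f := fun s ↦ y (-s))
      (f' := fun s ↦ -(y' (-s))) (a := 0) (b := -t) (K := K) (ε := δ) (δ := ‖y 0‖)
      (fun s hs ↦ (hd s hs).continuousAt.continuousWithinAt)
      (fun s hs ↦ (hd s (Ico_subset_Icc_self hs)).hasDerivWithinAt) (by simp)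
      (fun s hs ↦ by simpa using bound (-s) (hmem s (Ico_subset_Icc_self hs)))
      (-t) (right_mem_Icc.2 (by linarith))
    simpa [abs_of_nonpos ht] using this

/-- Taylor's estimate of first order for a map with Lipschitz derivative on a convex set. -/
theorem Convex.norm_sub_sub_fderiv_le {X : P → P} {B : Set P} (hB : Convex ℝ B) {L : ℝ}
    (hL : 0 ≤ L)
    (hX : ∀ x ∈ B, DifferentiableAt ℝ X x)
    (hLip : ∀ x ∈ B, ∀ y ∈ B, ‖fderiv ℝ X x - fderiv ℝ X y‖ ≤ L * ‖x - y‖)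
    {a b : P} (ha : a ∈ B) (hb : b ∈ B) :
    ‖X b - X a - fderiv ℝ X a (b - a)‖ ≤ L * ‖b - a‖ ^ 2 := by
  have hseg : segment ℝ a b ⊆ B := hB.segment_subset ha hb
  -- The mean value inequality for `X - fderiv ℝ X a` on the segment from `a` to `b`, where the
  -- derivative has norm at most `L * ‖b - a‖`.
  have := (convex_segment a b).norm_image_sub_le_of_norm_hasFDerivWithin_le' (f := X)
    (f' := fderiv ℝ X) (φ := fderiv ℝ X a) (C := L * ‖b - a‖)
    (fun x hx ↦ (hX x (hseg hx)).hasFDerivAt.hasFDerivWithinAt)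
    (fun x hx ↦ (hLip x (hseg hx) a ha).trans <| by
      gcongr
      obtain ⟨s, hs, rfl⟩ := (segment_eq_image' ℝ a b ▸ hx : x ∈ (fun s : ℝ ↦ a + s • (b - a)) '' Icc 0 1)
      simpa [norm_smul, abs_of_nonneg hs.1] using
        mul_le_of_le_one_left (norm_nonneg (b - a)) hs.2)
    (left_mem_segment ℝ a b) (right_mem_segment ℝ a b)
  calc _ ≤ L * ‖b - a‖ * ‖b - a‖ := this
    _ = _ := by ring

/-- A solution of the variational equation along a flow is the derivative of the flow with respect
to the initial value. -/
theorem hasFDerivAt_flow_of_variational {X : P → P} {B U : Set P} (hB : Convex ℝ B)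
    (hU : IsOpen U) {K L ε : ℝ} (hK : 0 < K) (hL : 0 ≤ L)
    (hX : ∀ x ∈ B, DifferentiableAt ℝ X x) (hbd : ∀ x ∈ B, ‖fderiv ℝ X x‖ ≤ K)
    (hLip : ∀ x ∈ B, ∀ y ∈ B, ‖fderiv ℝ X x - fderiv ℝ X y‖ ≤ L * ‖x - y‖)
    {F : ℝ → P → P} {A : ℝ → P → P →L[ℝ] P}
    (hF0 : ∀ x ∈ U, F 0 x = x) (hA0 : ∀ x ∈ U, A 0 x = ContinuousLinearMap.id ℝ P)
    (hFB : ∀ x ∈ U, ∀ t ∈ Ioo (-ε) ε, F t x ∈ B)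
    (hF : ∀ x ∈ U, ∀ t ∈ Ioo (-ε) ε, HasDerivAt (F · x) (X (F t x)) t)
    (hA : ∀ x ∈ U, ∀ t ∈ Ioo (-ε) ε, HasDerivAt (A · x) (fderiv ℝ X (F t x) ∘L A t x) t)
    {x : P} (hx : x ∈ U) {t : ℝ} (ht : t ∈ Ioo (-ε) ε) :
    HasFDerivAt (F t) (A t x) x := by
  have hsub : uIcc 0 t ⊆ Ioo (-ε) ε := by
    have h0 : (0 : ℝ) ∈ Ioo (-ε) ε := ⟨by linarith [ht.1, ht.2], by linarith [ht.1, ht.2]⟩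
    exact ordConnected_Ioo.uIcc_subset h0 ht
  set C : ℝ := Real.exp (K * ε) with hC
  have hεpos : 0 ≤ ε := by linarith [ht.1, ht.2]
  have habs : ∀ s ∈ uIcc 0 t, |s| ≤ ε := fun s hs ↦ abs_le.2 ⟨(hsub hs).1.le, (hsub hs).2.le⟩
  have hsub' : ∀ s ∈ uIcc 0 t, uIcc 0 s ⊆ uIcc 0 t := fun s hs ↦ uIcc_subset_uIcc_left hs
  -- The flow is Lipschitz in the initial value, with one constant `C = exp (K ε)` for all times
  -- involved.
  have key1 : ∀ z ∈ U, ∀ s ∈ uIcc 0 t, ‖F s z - F s x‖ ≤ C * ‖z - x‖ := by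
    intro z hz s hs
    have h1 := norm_le_gronwallBound_abs (y := fun r ↦ F r z - F r x)
      (y' := fun r ↦ X (F r z) - X (F r x)) (K := K) (δ := 0) (t := s)
      (fun r hr ↦ (hF z hz r (hsub (hsub' s hs hr))).sub (hF x hx r (hsub (hsub' s hs hr))))
      (fun r hr ↦ by
        have hr' := hsub (hsub' s hs hr)
        simpa using hB.norm_image_sub_le_of_norm_fderiv_le hX hbd (hFB x hx r hr') (hFB z hz r hr'))
    simp only [hF0 z hz, hF0 x hx, gronwallBound_ε0] at h1
    rw [mul_comm]
    refine h1.trans (mul_le_mul_of_nonneg_left (Real.exp_le_exp.2 ?_) (norm_nonneg _))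
    exact mul_le_mul_of_nonneg_left (habs s hs) hK.le
  -- The remainder starts at `0` and solves the linearized equation up to a Taylor error that is
  -- quadratic in `‖F r z - F r x‖`, hence in `‖z - x‖` by `key1`. Grönwall keeps it quadratic.
  have key2 : ∀ z ∈ U, ‖F t z - F t x - A t x (z - x)‖ ≤
      L * C ^ 2 / K * (Real.exp (K * |t|) - 1) * ‖z - x‖ ^ 2 := by
    intro z hz
    have h1 := norm_le_gronwallBound_abs (y := fun r ↦ F r z - F r x - A r x (z - x))
      (y' := fun r ↦ X (F r z) - X (F r x) - fderiv ℝ X (F r x) (A r x (z - x)))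
      (K := K) (δ := L * (C * ‖z - x‖) ^ 2) (t := t)
      (fun r hr ↦ ((hF z hz r (hsub hr)).sub (hF x hx r (hsub hr))).sub
        (by simpa using (hA x hx r (hsub hr)).clm_apply (hasDerivAt_const r (z - x))))
      (fun r hr ↦ by
        have hz' := hFB z hz r (hsub hr)
        have hx' := hFB x hx r (hsub hr)
        have e : X (F r z) - X (F r x) - fderiv ℝ X (F r x) (A r x (z - x)) =
            fderiv ℝ X (F r x) (F r z - F r x - A r x (z - x)) +
            (X (F r z) - X (F r x) - fderiv ℝ X (F r x) (F r z - F r x)) := by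
          simp only [map_sub]; abel
        rw [e]
        refine (norm_add_le _ _).trans (add_le_add ?_ ?_)
        · exact (ContinuousLinearMap.le_opNorm _ _).trans (by gcongr; exact hbd _ hx')
        · refine (hB.norm_sub_sub_fderiv_le hL hX hLip hx' hz').trans ?_
          gcongr
          exact key1 z hz r hr)
    simp only [hF0 z hz, hF0 x hx, hA0 x hx, ContinuousLinearMap.id_apply, sub_self, norm_zero,
      gronwallBound_of_K_ne_0 hK.ne'] at h1
    refine h1.trans (le_of_eq ?_)
    ring
  rw [hasFDerivAt_iff_isLittleO]
  have hO : (fun z ↦ F t z - F t x - A t x (z - x)) =O[𝓝 x] fun z ↦ ‖z - x‖ ^ 2 := by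
    refine Asymptotics.IsBigO.of_bound (L * C ^ 2 / K * (Real.exp (K * |t|) - 1)) ?_
    filter_upwards [hU.mem_nhds hx] with z hz
    simpa using key2 z hz
  refine hO.trans_isLittleO ?_
  have := (Asymptotics.isLittleO_pow_id (𝕜 := ℝ) (n := 2) one_lt_two).comp_tendsto
    (show Filter.Tendsto (fun z ↦ ‖z - x‖) (𝓝 x) (𝓝 0) from by
      simpa using (continuous_id.sub continuous_const).norm.tendsto x (f := fun z ↦ ‖z - x‖))
  exact this.trans_isBigO (Asymptotics.isBigO_refl _ _).norm_left

end Gronwall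

/-! ### Local flows of every finite order of differentiability in Banach spaces. -/

section Flow

universe u

/-- The vector field of the equation `x' = X x` together with its variational equation. -/
noncomputable def variationalField {P : Type*} [NormedAddCommGroup P] [NormedSpace ℝ P]
    (X : P → P) (z : P × (P →L[ℝ] P)) : P × (P →L[ℝ] P) :=
  (X z.1, fderiv ℝ X z.1 ∘L z.2)

theorem ContDiffOn.variationalField {P : Type*} [NormedAddCommGroup P] [NormedSpace ℝ P]
    {X : P → P} {s : Set P} (hs : IsOpen s) (hX : ContDiffOn ℝ ∞ X s)
    (t : Set (P →L[ℝ] P)) : ContDiffOn ℝ ∞ (_root_.variationalField X) (s ×ˢ t) := by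
  have h1 : ContDiffOn ℝ ∞ (fderiv ℝ X) s := hX.fderiv_of_isOpen hs (by simp)
  refine (hX.comp contDiffOn_fst fun z hz ↦ hz.1).prodMk ?_
  exact (h1.comp contDiffOn_fst fun z hz ↦ hz.1).clm_comp contDiffOn_snd

/-- A smooth vector field has, for every `n`, a local flow that is `C^n` in the initial value. -/
def HasContDiffFlows (n : ℕ) : Prop :=
  ∀ {P : Type u} [NormedAddCommGroup P] [NormedSpace ℝ P] [CompleteSpace P] (X : P → P)
    (s : Set P), IsOpen s → ContDiffOn ℝ ∞ X s → ∀ x₀ ∈ s,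
    ∃ ε > 0, ∃ U, IsOpen U ∧ x₀ ∈ U ∧ ∃ F : ℝ → P → P, ∀ x ∈ U, F 0 x = x ∧
      ∀ t ∈ Ioo (-ε) ε, F t x ∈ s ∧ HasDerivAt (F · x) (X (F t x)) t ∧ ContDiffAt ℝ n (F t) x

/-- Picard–Lindelöf gives a jointly continuous flow near `(x₀, 0)`. By continuity there, the time
interval and the neighbourhood can be shrunk until all curves stay in `s`. -/
theorem hasContDiffFlows_zero : HasContDiffFlows.{u} 0 := by
  intro P _ _ _ X s hs hX x₀ hx₀
  obtain ⟨ε, hε, a, r, L, K, hr, h⟩ := IsPicardLindelof.of_contDiffAt_one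
    ((hX.contDiffAt (hs.mem_nhds hx₀)).of_le (by simp))
  obtain ⟨α, hα, hc⟩ := (h 0).exists_forall_mem_closedBall_eq_hasDerivWithinAt_continuousOn
  simp only [zero_sub, zero_add] at hα hc
  have hr' : (0 : ℝ) < r := hr
  have hnhds : Metric.closedBall x₀ (r : ℝ) ×ˢ Icc (-ε) ε ∈ 𝓝 (x₀, (0 : ℝ)) :=
    prod_mem_nhds (Metric.closedBall_mem_nhds _ hr') (Icc_mem_nhds (by linarith) hε)
  have hev : ∀ᶠ z in 𝓝 (x₀, (0 : ℝ)), α z ∈ s := by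
    refine (hc.continuousAt hnhds).eventually_mem (hs.mem_nhds ?_)
    rwa [(hα x₀ (Metric.mem_closedBall_self hr'.le)).1]
  rw [nhds_prod_eq, Filter.eventually_prod_iff] at hev
  obtain ⟨p, hp, q, hq, hpq⟩ := hev
  obtain ⟨δ, hδ, hq⟩ := Metric.eventually_nhds_iff_ball.1 hq
  obtain ⟨U, hUp, hU, hxU⟩ := eventually_nhds_iff.1 hp
  refine ⟨min δ ε, lt_min hδ hε, U ∩ Metric.ball x₀ r, hU.inter Metric.isOpen_ball,
    ⟨hxU, Metric.mem_ball_self hr'⟩, fun t x ↦ α (x, t), ?_⟩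
  rintro x ⟨hx, hxr⟩
  have hxc := Metric.ball_subset_closedBall hxr
  refine ⟨(hα x hxc).1, fun t ht ↦ ?_⟩
  have ht1 : t ∈ Ioo (-ε) ε := ⟨by linarith [ht.1, min_le_right δ ε], ht.2.trans_le (min_le_right _ _)⟩
  refine ⟨hpq (hUp x hx) (hq t ?_), ?_, ?_⟩
  · rw [Real.ball_eq_Ioo]
    exact ⟨by linarith [ht.1, min_le_left δ ε], by linarith [ht.2, min_le_left δ ε]⟩
  · exact ((hα x hxc).2 t (Ioo_subset_Icc_self ht1)).hasDerivAt (Icc_mem_nhds ht1.1 ht1.2)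
  · rw [Nat.cast_zero, contDiffAt_zero]
    refine ⟨_, Metric.isOpen_ball.mem_nhds hxr, ?_⟩
    exact hc.comp (by fun_prop)
      fun z hz ↦ ⟨Metric.ball_subset_closedBall hz, Ioo_subset_Icc_self ht1⟩

/-- If flows are `C^n` in the initial value, then they are `C^(n+1)`, and their derivative in the
initial value is invertible for short times and solves the variational equation. -/
theorem HasContDiffFlows.exists_flow_hasFDerivAt {n : ℕ} (hn : HasContDiffFlows.{u} n)
    {P : Type u} [NormedAddCommGroup P] [NormedSpace ℝ P] [CompleteSpace P] (X : P → P)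
    (s : Set P) (hs : IsOpen s) (hX : ContDiffOn ℝ ∞ X s) (x₀ : P) (hx₀ : x₀ ∈ s) :
    ∃ ε > 0, ∃ U, IsOpen U ∧ x₀ ∈ U ∧ ∃ (F : ℝ → P → P) (A : ℝ → P → P →L[ℝ] P),
      ∀ x ∈ U, F 0 x = x ∧ A 0 x = ContinuousLinearMap.id ℝ P ∧
      ∀ t ∈ Ioo (-ε) ε, F t x ∈ s ∧ HasDerivAt (F · x) (X (F t x)) t ∧
        HasDerivAt (A · x) (fderiv ℝ X (F t x) ∘L A t x) t ∧
        HasFDerivAt (F t) (A t x) x ∧ (A t x).IsInvertible ∧ ContDiffAt ℝ (n + 1 : ℕ) (F t) x := by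
  have hX1 : ContDiffOn ℝ ∞ (fderiv ℝ X) s := hX.fderiv_of_isOpen hs (by simp)
  obtain ⟨L, N, hN, hL⟩ :=
    ((hX1.contDiffAt (hs.mem_nhds hx₀)).of_le (by simp)).exists_lipschitzOnWith
  have hK : ∀ᶠ x in 𝓝 x₀, ‖fderiv ℝ X x‖ < ‖fderiv ℝ X x₀‖ + 1 :=
    ((hX1.contDiffAt (hs.mem_nhds hx₀)).continuousAt.norm).eventually_lt continuousAt_const
      (by simp)
  obtain ⟨r, hr, hball⟩ := Metric.mem_nhds_iff.1
    (Filter.inter_mem (Filter.inter_mem hN (hs.mem_nhds hx₀)) hK)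
  -- Invertible operators contain a ball around the identity. Confining the variational solution to
  -- this ball makes the derivative of the flow invertible.
  have hinv : {B : P →L[ℝ] P | B.IsInvertible} ∈ 𝓝 (ContinuousLinearMap.id ℝ P) := by
    have := ContinuousLinearEquiv.nhds (ContinuousLinearEquiv.refl ℝ P)
    refine Filter.mem_of_superset this ?_
    rintro _ ⟨e, rfl⟩
    exact ⟨e, rfl⟩
  obtain ⟨ρ, hρ, hinv⟩ := Metric.mem_nhds_iff.1 hinv
  have hbs : Metric.ball x₀ r ⊆ s := fun x hx ↦ (hball hx).1.2
  -- The hypothesis is used on the larger space `P × (P →L[ℝ] P)`; this is why `HasContDiffFlows`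
  -- quantifies over all Banach spaces of the universe. The first ball is convex and carries the
  -- bounds on `fderiv ℝ X`.
  obtain ⟨ε, hε, U, hU, hxU, Φ, hΦ⟩ := hn (variationalField X)
    (Metric.ball x₀ r ×ˢ Metric.ball (ContinuousLinearMap.id ℝ P) ρ)
    (Metric.isOpen_ball.prod Metric.isOpen_ball)
    ((hX.mono hbs).variationalField Metric.isOpen_ball _)
    (x₀, ContinuousLinearMap.id ℝ P) ⟨Metric.mem_ball_self hr, Metric.mem_ball_self hρ⟩
  have hι : ContDiff ℝ ∞ fun x : P ↦ (x, ContinuousLinearMap.id ℝ P) := by fun_prop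
  have hU' := hU.preimage hι.continuous
  refine ⟨ε, hε, _, hU', hxU, fun t x ↦ (Φ t (x, ContinuousLinearMap.id ℝ P)).1,
    fun t x ↦ (Φ t (x, ContinuousLinearMap.id ℝ P)).2, fun x hx ↦ ?_⟩
  refine ⟨congrArg Prod.fst (hΦ _ hx).1, congrArg Prod.snd (hΦ _ hx).1, fun t ht ↦ ?_⟩
  have hF : ∀ x ∈ (fun x : P ↦ (x, ContinuousLinearMap.id ℝ P)) ⁻¹' U, ∀ t ∈ Ioo (-ε) ε,
      HasDerivAt (fun t ↦ (Φ t (x, ContinuousLinearMap.id ℝ P)).1)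
        (X (Φ t (x, ContinuousLinearMap.id ℝ P)).1) t := fun x hx t ht ↦
    ((hΦ _ hx).2 t ht).2.1.fst
  have hA : ∀ x ∈ (fun x : P ↦ (x, ContinuousLinearMap.id ℝ P)) ⁻¹' U, ∀ t ∈ Ioo (-ε) ε,
      HasDerivAt (fun t ↦ (Φ t (x, ContinuousLinearMap.id ℝ P)).2)
        (fderiv ℝ X (Φ t (x, ContinuousLinearMap.id ℝ P)).1 ∘L
          (Φ t (x, ContinuousLinearMap.id ℝ P)).2) t := fun x hx t ht ↦
    ((hΦ _ hx).2 t ht).2.1.snd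
  have hFA : ∀ x ∈ (fun x : P ↦ (x, ContinuousLinearMap.id ℝ P)) ⁻¹' U,
      HasFDerivAt (fun x ↦ (Φ t (x, ContinuousLinearMap.id ℝ P)).1)
        (Φ t (x, ContinuousLinearMap.id ℝ P)).2 x := by
    intro x hx
    refine hasFDerivAt_flow_of_variational (X := X) (U := _) (ε := ε)
      (F := fun t x ↦ (Φ t (x, ContinuousLinearMap.id ℝ P)).1)
      (A := fun t x ↦ (Φ t (x, ContinuousLinearMap.id ℝ P)).2)
      (convex_ball x₀ r) hU' (K := ‖fderiv ℝ X x₀‖ + 1) (L := L)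
      (by positivity) L.2 (fun x hx ↦ (hX.contDiffAt (hs.mem_nhds (hbs hx))).differentiableAt
        (by simp)) (fun x hx ↦ (hball hx).2.le)
      (fun x hx y hy ↦ hL.norm_sub_le (hball hx).1.1 (hball hy).1.1)
      (fun x hx ↦ congrArg Prod.fst (hΦ _ hx).1) (fun x hx ↦ congrArg Prod.snd (hΦ _ hx).1)
      (fun x hx t ht ↦ ((hΦ _ hx).2 t ht).1.1) hF hA hx ht
  refine ⟨hbs ((hΦ _ hx).2 t ht).1.1, hF x hx t ht, hA x hx t ht, hFA x hx,
    hinv ((hΦ _ hx).2 t ht).1.2, ?_⟩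
  push_cast
  -- The derivative of the flow is the second component of `Φ`, which is `C^n` by hypothesis, so the
  -- flow itself is `C^(n+1)`.
  exact contDiffAt_succ_iff_hasFDerivAt.2 ⟨_, ⟨_, hU'.mem_nhds hx, hFA⟩,
    (((hΦ _ hx).2 t ht).2.2.comp x (hι.of_le (by exact_mod_cast le_top)).contDiffAt).snd⟩

theorem hasContDiffFlows (n : ℕ) : HasContDiffFlows.{u} n := by
  induction n with
  | zero => exact hasContDiffFlows_zero
  | succ n ih =>
    intro P _ _ _ X s hs hX x₀ hx₀
    obtain ⟨ε, hε, U, hU, hxU, F, A, h⟩ := ih.exists_flow_hasFDerivAt X s hs hX x₀ hx₀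
    exact ⟨ε, hε, U, hU, hxU, F, fun x hx ↦ ⟨(h x hx).1, fun t ht ↦
      ⟨((h x hx).2.2 t ht).1, ((h x hx).2.2 t ht).2.1, ((h x hx).2.2 t ht).2.2.2.2.2⟩⟩⟩

end Flow

/-! ### Invariance of an exact two-form under a Hamiltonian flow, in coordinates. -/

section ClosedForm

variable {P : Type*} [NormedAddCommGroup P] [NormedSpace ℝ P]

/-- The two-form `-dθ` of a one-form `θ`. -/
noncomputable def negExtDeriv (θ : P → P →L[ℝ] ℝ) (x ξ ζ : P) : ℝ :=
  fderiv ℝ θ x ζ ξ - fderiv ℝ θ x ξ ζ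

set_option synthInstance.maxHeartbeats 400000 in
/-- The infinitesimal form of the invariance of `-dθ` under the flow of a vector field `X` whose
contraction with `-dθ` is exact. -/
theorem negExtDeriv_lie_eq_zero {s : Set P} (hs : IsOpen s) {θ : P → P →L[ℝ] ℝ} {X : P → P}
    {h : P → ℝ} (hθ : ContDiffOn ℝ ∞ θ s) (hX : ContDiffOn ℝ ∞ X s) (hh : ContDiffOn ℝ ∞ h s)
    (ham : ∀ x ∈ s, ∀ ζ, negExtDeriv θ x (X x) ζ = fderiv ℝ h x ζ) {x : P} (hx : x ∈ s)
    (ξ ζ : P) :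
    (fderiv ℝ (fderiv ℝ θ) x (X x) ζ ξ - fderiv ℝ (fderiv ℝ θ) x (X x) ξ ζ) +
      negExtDeriv θ x (fderiv ℝ X x ξ) ζ + negExtDeriv θ x ξ (fderiv ℝ X x ζ) = 0 := by
  have hθ' := hθ.contDiffAt (hs.mem_nhds hx)
  have hh' := hh.contDiffAt (hs.mem_nhds hx)
  have h1 : HasFDerivAt (fderiv ℝ θ) (fderiv ℝ (fderiv ℝ θ) x) x :=
    ((hθ'.fderiv_right (m := ∞) (by simp)).differentiableAt (by simp)).hasFDerivAt
  have h2 : HasFDerivAt X (fderiv ℝ X x) x :=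
    ((hX.contDiffAt (hs.mem_nhds hx)).differentiableAt (by simp)).hasFDerivAt
  have h3 : HasFDerivAt (fderiv ℝ h) (fderiv ℝ (fderiv ℝ h) x) x :=
    ((hh'.fderiv_right (m := ∞) (by simp)).differentiableAt (by simp)).hasFDerivAt
  -- The identity `ham` differentiated in the direction `a`, with `b` held fixed.
  have hdiff : ∀ a b : P, fderiv ℝ (fderiv ℝ θ) x a b (X x) + fderiv ℝ θ x b (fderiv ℝ X x a) -
      (fderiv ℝ (fderiv ℝ θ) x a (X x) b + fderiv ℝ θ x (fderiv ℝ X x a) b) =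
      fderiv ℝ (fderiv ℝ h) x a b := by
    intro a b
    have e1 : HasFDerivAt (fun y ↦ negExtDeriv θ y (X y) b) _ x :=
      ((h1.clm_apply (hasFDerivAt_const b x)).clm_apply h2).sub
        ((h1.clm_apply h2).clm_apply (hasFDerivAt_const b x))
    have e2 := h3.clm_apply (hasFDerivAt_const b x)
    have e3 := e1.unique (e2.congr_of_eventuallyEq
      (Filter.eventually_of_mem (hs.mem_nhds hx) fun y hy ↦ ham y hy b))
    have e4 := congrArg (fun φ : P →L[ℝ] ℝ ↦ φ a) e3
    simp at e4
    linarith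
  have sθ : ∀ a b, fderiv ℝ (fderiv ℝ θ) x a b = fderiv ℝ (fderiv ℝ θ) x b a :=
    fun a b ↦ (hθ'.isSymmSndFDerivAt (by simpa using ENat.LEInfty.out)) a b
  have sh : ∀ a b, fderiv ℝ (fderiv ℝ h) x a b = fderiv ℝ (fderiv ℝ h) x b a :=
    fun a b ↦ (hh'.isSymmSndFDerivAt (by simpa using ENat.LEInfty.out)) a b
  have e1 := hdiff ξ ζ
  have e2 := hdiff ζ ξ
  -- Antisymmetrizing in `ξ, ζ` cancels the Hessian of `h` and the terms with `D²θ(ξ, ζ)`: this is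
  -- `d(dh) = 0` and `d(dθ) = 0` in Cartan's formula.
  rw [sθ ζ ξ, sh ζ ξ] at e2
  rw [sθ (X x) ζ, sθ (X x) ξ]
  simp only [negExtDeriv]
  linarith

/-- The flow of a Hamiltonian vector field preserves the two-form `-dθ`. -/
theorem negExtDeriv_flow_eq {s : Set P} (hs : IsOpen s) {θ : P → P →L[ℝ] ℝ} {X : P → P}
    {h : P → ℝ} (hθ : ContDiffOn ℝ ∞ θ s) (hX : ContDiffOn ℝ ∞ X s) (hh : ContDiffOn ℝ ∞ h s)
    (ham : ∀ x ∈ s, ∀ ζ, negExtDeriv θ x (X x) ζ = fderiv ℝ h x ζ) {γ : ℝ → P}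
    {A : ℝ → P →L[ℝ] P} {ε : ℝ} (hγs : ∀ t ∈ Ioo (-ε) ε, γ t ∈ s)
    (hγ : ∀ t ∈ Ioo (-ε) ε, HasDerivAt γ (X (γ t)) t)
    (hA : ∀ t ∈ Ioo (-ε) ε, HasDerivAt A (fderiv ℝ X (γ t) ∘L A t) t)
    (hA0 : A 0 = ContinuousLinearMap.id ℝ P) {t : ℝ} (ht : t ∈ Ioo (-ε) ε) (ξ ζ : P) :
    negExtDeriv θ (γ t) (A t ξ) (A t ζ) = negExtDeriv θ (γ 0) ξ ζ := by
  -- The product rule with the variational equation turns the time derivative into the Lie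
  -- derivative evaluated on `A t ξ` and `A t ζ`, which is zero.
  have hd : ∀ t ∈ Ioo (-ε) ε,
      HasDerivAt (fun t ↦ negExtDeriv θ (γ t) (A t ξ) (A t ζ)) 0 t := by
    intro t ht
    have hθ' := hθ.contDiffAt (hs.mem_nhds (hγs t ht))
    have h1 : HasDerivAt (fun t ↦ fderiv ℝ θ (γ t))
        (fderiv ℝ (fderiv ℝ θ) (γ t) (X (γ t))) t :=
      ((hθ'.fderiv_right (m := ∞) (by simp)).differentiableAt
        (by simp)).hasFDerivAt.comp_hasDerivAt t (hγ t ht)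
    have h2 : ∀ a : P, HasDerivAt (fun t ↦ A t a) (fderiv ℝ X (γ t) (A t a)) t := fun a ↦ by
      simpa using (hA t ht).clm_apply (hasDerivAt_const t a)
    have := ((h1.clm_apply (h2 ζ)).clm_apply (h2 ξ)).sub ((h1.clm_apply (h2 ξ)).clm_apply (h2 ζ))
    refine this.congr_deriv ?_
    have key := negExtDeriv_lie_eq_zero hs hθ hX hh ham (hγs t ht) (A t ξ) (A t ζ)
    simp only [negExtDeriv] at key
    simp only [_root_.add_apply]
    linarith
  have h0 : (0 : ℝ) ∈ Ioo (-ε) ε := ⟨by linarith [ht.1, ht.2], by linarith [ht.1, ht.2]⟩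
  have := isOpen_Ioo.is_const_of_deriv_eq_zero isPreconnected_Ioo
    (fun t ht ↦ (hd t ht).differentiableAt.differentiableWithinAt)
    (fun t ht ↦ (hd t ht).deriv) ht h0
  simpa [hA0] using this

end ClosedForm

/-! ### Local symplectic flows on a manifold. -/

section ManifoldFlow

universe u

variable {P : Type u} [NormedAddCommGroup P] [NormedSpace ℝ P] {H : Type*}
  [TopologicalSpace H] {I : ModelWithCorners ℝ P H} {M : Type*} [TopologicalSpace M]
  [ChartedSpace H M]

/-- The two-form `Ω` is, in charts, of the form `-dθ`, and the contraction of `Ω` with the vector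
field `X` is, in charts, exact. -/
def IsLocallyHamiltonian (Ω : ∀ x : M, TangentSpace I x → TangentSpace I x → ℝ)
    (X : ∀ x : M, TangentSpace I x) : Prop :=
  ∀ x₀ : M, ∃ s ⊆ (extChartAt I x₀).target, IsOpen s ∧ extChartAt I x₀ x₀ ∈ s ∧
    ∃ (θ : P → P →L[ℝ] ℝ) (h : P → ℝ), ContDiffOn ℝ ∞ θ s ∧ ContDiffOn ℝ ∞ h s ∧
      ∀ y ∈ s, ∀ ξ ζ : TangentSpace I ((extChartAt I x₀).symm y),
        Ω _ ξ ζ = negExtDeriv θ y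
          (mfderiv I 𝓘(ℝ, P) (extChartAt I x₀) ((extChartAt I x₀).symm y) ξ)
          (mfderiv I 𝓘(ℝ, P) (extChartAt I x₀) ((extChartAt I x₀).symm y) ζ) ∧
        Ω _ (X ((extChartAt I x₀).symm y)) ζ = fderiv ℝ h y
          (mfderiv I 𝓘(ℝ, P) (extChartAt I x₀) ((extChartAt I x₀).symm y) ζ)

variable [IsManifold I ∞ M]

theorem contDiffOn_mfderiv_extChartAt_symm [I.Boundaryless] {X : ∀ x : M, TangentSpace I x}
    (hX : ContMDiff I I.tangent ∞ (fun x ↦ (⟨x, X x⟩ : TangentBundle I M))) (x₀ : M) :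
    ContDiffOn ℝ ∞ (fun y : P ↦ (mfderiv I 𝓘(ℝ, P) (extChartAt I x₀)
      ((extChartAt I x₀).symm y) (X ((extChartAt I x₀).symm y)) : P)) (extChartAt I x₀).target := by
  have h1 := (trivializationAt P (TangentSpace I) x₀).contMDiffOn_section_baseSet_iff.1
    (hX.contMDiffOn (s := (trivializationAt P (TangentSpace I) x₀).baseSet))
  have hmaps : ∀ y ∈ (extChartAt I x₀).target, (extChartAt I x₀).symm y ∈
      (chartAt H x₀).source := fun y hy ↦ by
    simpa using (extChartAt I x₀).map_target hy
  have h2 := h1.comp (contMDiffOn_extChartAt_symm (n := ∞) x₀) hmaps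
  rw [contMDiffOn_iff_contDiffOn] at h2
  refine h2.congr fun y hy ↦ ?_
  rw [← TangentBundle.continuousLinearMapAt_trivializationAt (hmaps y hy)]
  exact Trivialization.continuousLinearMapAt_apply_of_mem ℝ _ (hmaps y hy) _

variable [I.Boundaryless]

theorem hasMFDerivAt_extChartAt_symm {x₀ : M} {y : P} (hy : y ∈ (extChartAt I x₀).target) :
    HasMFDerivAt 𝓘(ℝ, P) I (extChartAt I x₀).symm y
      (mfderiv 𝓘(ℝ, P) I (extChartAt I x₀).symm y) := by
  have := mdifferentiableWithinAt_extChartAt_symm (I := I) hy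
  rw [I.range_eq_univ, mdifferentiableWithinAt_univ] at this
  exact this.hasMFDerivAt

theorem mfderiv_extChartAt_symm_mfderiv_extChartAt {x₀ : M} {y : P}
    (hy : y ∈ (extChartAt I x₀).target)
    (ξ : TangentSpace I ((extChartAt I x₀).symm y)) :
    mfderiv 𝓘(ℝ, P) I (extChartAt I x₀).symm y
      (mfderiv I 𝓘(ℝ, P) (extChartAt I x₀) ((extChartAt I x₀).symm y) ξ) = ξ := by
  have := mfderivWithin_extChartAt_symm_comp_mfderiv_extChartAt (I := I) hy
  rw [I.range_eq_univ, mfderivWithin_univ] at this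
  exact congrArg (fun φ ↦ φ ξ) this

theorem mfderiv_extChartAt_mfderiv_extChartAt_symm {x₀ : M} {y : P}
    (hy : y ∈ (extChartAt I x₀).target) (v : P) :
    mfderiv I 𝓘(ℝ, P) (extChartAt I x₀) ((extChartAt I x₀).symm y)
      (mfderiv 𝓘(ℝ, P) I (extChartAt I x₀).symm y v) = v := by
  have := mfderiv_extChartAt_comp_mfderivWithin_extChartAt_symm (I := I) hy
  rw [I.range_eq_univ, mfderivWithin_univ] at this
  exact congrArg (fun φ ↦ φ v) this

/-- `f` is `C^n` at `x`, with invertible derivative that preserves the two-form `Ω`. -/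
structure IsSymplecticAt (Ω : ∀ x : M, TangentSpace I x → TangentSpace I x → ℝ) (n : ℕ∞)
    (f : M → M) (x : M) : Prop where
  contMDiffAt : ContMDiffAt I I n f x
  isInvertible : (mfderiv I I f x).IsInvertible
  map_form : ∀ ξ ζ : TangentSpace I x, Ω (f x) (mfderiv I I f x ξ) (mfderiv I I f x ζ) = Ω x ξ ζ

omit [IsManifold I ∞ M] [I.Boundaryless] in
theorem IsSymplecticAt.congr {Ω : ∀ x : M, TangentSpace I x → TangentSpace I x → ℝ} {n : ℕ∞}
    {f f' : M → M} {x : M} (h : IsSymplecticAt Ω n f x) (hf : f' =ᶠ[𝓝 x] f) :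
    IsSymplecticAt Ω n f' x := by
  -- The tangent spaces at `f' x` and `f x` are distinct types that both unfold to `P`; vectors are
  -- taken in `P` so that the base point can be substituted.
  have hΩ : ∀ (y : M) (_ : y = f x) (a b : P), Ω y a b = Ω (f x) a b := by
    rintro _ rfl _ _; rfl
  have hd : ∀ ξ : P, (mfderiv I I f' x ξ : P) = mfderiv I I f x ξ :=
    fun ξ ↦ congrArg (fun φ : P →L[ℝ] P ↦ φ ξ) hf.mfderiv_eq
  refine ⟨h.contMDiffAt.congr_of_eventuallyEq hf, ?_, fun ξ ζ ↦ ?_⟩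
  · have := h.isInvertible
    rw [← hf.mfderiv_eq] at this
    exact this
  · exact (hΩ _ hf.eq_of_nhds _ _).trans
      ((congrArg₂ (Ω (f x)) (hd ξ) (hd ζ)).trans (h.map_form ξ ζ))

omit [IsManifold I ∞ M] [I.Boundaryless] in
theorem IsSymplecticAt.comp {Ω : ∀ x : M, TangentSpace I x → TangentSpace I x → ℝ} {n : ℕ∞}
    (hn : 1 ≤ n) {f f' : M → M} {x : M} (h' : IsSymplecticAt Ω n f' (f x))
    (h : IsSymplecticAt Ω n f x) : IsSymplecticAt Ω n (f' ∘ f) x := by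
  have hn' : (n : WithTop ℕ∞) ≠ 0 := by
    simpa using (zero_lt_one.trans_le hn).ne'
  have hd := mfderiv_comp x (h'.contMDiffAt.mdifferentiableAt hn')
    (h.contMDiffAt.mdifferentiableAt hn')
  refine ⟨h'.contMDiffAt.comp x h.contMDiffAt, ?_, fun ξ ζ ↦ ?_⟩
  · rw [hd]
    exact h'.isInvertible.comp h.isInvertible
  · rw [hd]
    exact (h'.map_form _ _).trans (h.map_form ξ ζ)

omit [IsManifold I ∞ M] [I.Boundaryless] in
theorem isSymplecticAt_id (Ω : ∀ x : M, TangentSpace I x → TangentSpace I x → ℝ) (n : ℕ∞)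
    (x : M) : IsSymplecticAt Ω n id x := by
  refine ⟨contMDiffAt_id, ?_, fun ξ ζ ↦ ?_⟩
  · rw [mfderiv_id]
    exact ⟨ContinuousLinearEquiv.refl ℝ _, rfl⟩
  · rw [mfderiv_id]
    rfl

/-- Hamiltonian vector fields have local flows by symplectic maps. -/
theorem exists_localFlow [CompleteSpace P] {Ω : ∀ x : M, TangentSpace I x → TangentSpace I x → ℝ}
    {X : ∀ x : M, TangentSpace I x}
    (hX : ContMDiff I I.tangent ∞ (fun x ↦ (⟨x, X x⟩ : TangentBundle I M)))
    (hΩ : IsLocallyHamiltonian Ω X) (n : ℕ) (x₀ : M) :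
    ∃ ε > 0, ∃ U, IsOpen U ∧ x₀ ∈ U ∧ ∃ Φ : ℝ → M → M, ∀ x ∈ U, Φ 0 x = x ∧
      IsMIntegralCurveOn (I := I) (Φ · x) X (Ioo (-ε) ε) ∧
      ∀ t ∈ Ioo (-ε) ε, IsSymplecticAt Ω n (Φ t) x := by
  obtain ⟨s, hst, hs, hxs, θ, h, hθ, hh, hΩ⟩ := hΩ x₀
  set φ := extChartAt I x₀ with hφ
  set Y : P → P := fun y ↦ mfderiv I 𝓘(ℝ, P) φ (φ.symm y) (X (φ.symm y)) with hYdef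
  have hY : ContDiffOn ℝ ∞ Y s := (contDiffOn_mfderiv_extChartAt_symm hX x₀).mono hst
  -- Every `v : P` is the coordinate vector of a tangent vector, so the Hamiltonian equation on the
  -- manifold yields the one in coordinates.
  have ham : ∀ y ∈ s, ∀ v, negExtDeriv θ y (Y y) v = fderiv ℝ h y v := by
    intro y hy v
    have := hΩ y hy (X (φ.symm y)) (mfderiv 𝓘(ℝ, P) I φ.symm y v)
    rw [mfderiv_extChartAt_mfderiv_extChartAt_symm (hst hy)] at this
    exact this.1.symm.trans this.2
  obtain ⟨ε, hε, W, hW, hxW, F, A, hFA⟩ :=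
    HasContDiffFlows.exists_flow_hasFDerivAt (hasContDiffFlows n) Y s hs hY _ hxs
  refine ⟨ε, hε, φ.source ∩ φ ⁻¹' (W ∩ s), (continuousOn_extChartAt x₀).isOpen_inter_preimage
    (isOpen_extChartAt_source x₀) (hW.inter hs), ⟨mem_extChartAt_source x₀, hxW, hxs⟩,
    fun t x ↦ φ.symm (F t (φ x)), ?_⟩
  rintro x ⟨hx, hxW, hxs⟩
  obtain ⟨hF0, hA0, hFA'⟩ := hFA _ hxW
  have h0 : φ.symm (F 0 (φ x)) = x := by rw [hF0, φ.left_inv hx]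
  refine ⟨h0, fun t ht ↦ ?_, fun t ht ↦ ?_⟩
  · obtain ⟨hFs, hFd, -⟩ := hFA' t ht
    have h1 := (hasMFDerivAt_extChartAt_symm (hst hFs)).comp t hFd.hasFDerivAt.hasMFDerivAt
    refine (h1.congr_mfderiv ?_).hasMFDerivWithinAt
    have h2 := mfderiv_extChartAt_symm_mfderiv_extChartAt (hst hFs) (X (φ.symm (F t (φ x))))
    refine ContinuousLinearMap.ext_ring ?_
    exact (congrArg (mfderiv 𝓘(ℝ, P) I φ.symm (F t (φ x))) (one_smul ℝ (Y (F t (φ x))))).trans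
      (h2.trans (one_smul ℝ (X (φ.symm (F t (φ x))))).symm)
  · obtain ⟨hFs, -, -, hFx, hAi, hFc⟩ := hFA' t ht
    have hd : HasMFDerivAt I I (fun x ↦ φ.symm (F t (φ x))) x
        (mfderiv 𝓘(ℝ, P) I φ.symm (F t (φ x)) ∘L (A t (φ x) ∘L mfderiv I 𝓘(ℝ, P) φ x)) :=
      (hasMFDerivAt_extChartAt_symm (hst hFs)).comp x
        (hFx.hasMFDerivAt.comp x (mdifferentiableAt_extChartAt (by simpa [hφ] using hx)).hasMFDerivAt)
    refine ⟨?_, ?_, fun ξ ζ ↦ ?_⟩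
    · have h1 : ContMDiffAt I 𝓘(ℝ, P) n φ x :=
        (contMDiffAt_extChartAt' (n := n) (by simpa [hφ] using hx))
      have h2 : ContMDiffAt 𝓘(ℝ, P) 𝓘(ℝ, P) n (F t) (φ x) :=
        (hFc.of_le (by simp)).contMDiffAt
      have h3 : ContMDiffAt 𝓘(ℝ, P) I n φ.symm (F t (φ x)) :=
        (contMDiffOn_extChartAt_symm (n := n) x₀).contMDiffAt
          ((isOpen_extChartAt_target x₀).mem_nhds (hst hFs))
      exact h3.comp x (h2.comp x h1)
    · rw [hd.mfderiv]
      refine ContinuousLinearMap.IsInvertible.comp ?_ (hAi.comp (isInvertible_mfderiv_extChartAt hx))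
      have := isInvertible_mfderivWithin_extChartAt_symm (I := I) (hst hFs)
      rwa [I.range_eq_univ, mfderivWithin_univ] at this
    · rw [hd.mfderiv, (hΩ _ hFs _ _).1]
      have e1 := mfderiv_extChartAt_mfderiv_extChartAt_symm (hst hFs)
      have key := negExtDeriv_flow_eq hs hθ hY hh ham (fun t ht ↦ (hFA' t ht).1)
        (fun t ht ↦ (hFA' t ht).2.1) (fun t ht ↦ (hFA' t ht).2.2.1) hA0 ht
        (mfderiv I 𝓘(ℝ, P) φ x ξ) (mfderiv I 𝓘(ℝ, P) φ x ζ)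
      have e2 : ∀ z (_ : z = x) (ξ ζ : P), Ω z ξ ζ = negExtDeriv θ (φ x)
          (mfderiv I 𝓘(ℝ, P) φ z ξ) (mfderiv I 𝓘(ℝ, P) φ z ζ) → 
          Ω x ξ ζ = negExtDeriv θ (φ x)
          (mfderiv I 𝓘(ℝ, P) φ x ξ) (mfderiv I 𝓘(ℝ, P) φ x ζ) := by
        rintro _ rfl _ _ h; exact h
      rw [e2 _ (φ.left_inv hx) ξ ζ (hΩ _ hxs _ _).1]
      rw [hF0] at key
      refine Eq.trans ?_ key
      congr 1
      · exact e1 _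
      · exact e1 _

end ManifoldFlow

/-! ### From short times to all times of the flow. -/

section GlobalFlow

universe u

variable {P : Type u} [NormedAddCommGroup P] [NormedSpace ℝ P] [CompleteSpace P] {H : Type*}
  [TopologicalSpace H] {I : ModelWithCorners ℝ P H} [I.Boundaryless] {M : Type*}
  [TopologicalSpace M] [T2Space M] [ChartedSpace H M] [IsManifold I ∞ M]

theorem ordConnected_of_uIcc_zero_subset {T : Set ℝ} (hT : ∀ t ∈ T, ∀ s ∈ uIcc 0 t, s ∈ T) :
    T.OrdConnected := by
  refine ⟨fun a ha b hb r hr ↦ ?_⟩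
  rcases le_total 0 r with h | h
  · exact hT b hb r (by rw [uIcc_of_le (h.trans hr.2)]; exact ⟨h, hr.2⟩)
  · exact hT a ha r (by rw [uIcc_of_ge (hr.1.trans h)]; exact ⟨hr.1, h⟩)

/-- Uniqueness of integral curves is applied on open intervals, so two times of a curve must be put
into one of them. Points between `r` and `r'` lie in `T` by order-connectedness, points outside in a
ball around one of the two. -/
theorem Set.OrdConnected.exists_Ioo_subset {T : Set ℝ} (hT : T.OrdConnected) (hT' : IsOpen T)
    {r r' : ℝ} (hr : r ∈ T) (hr' : r' ∈ T) :
    ∃ a b, r ∈ Ioo a b ∧ r' ∈ Ioo a b ∧ Ioo a b ⊆ T := by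
  obtain ⟨δ, hδ, h⟩ := Metric.isOpen_iff.1 hT' _ hr
  obtain ⟨δ', hδ', h'⟩ := Metric.isOpen_iff.1 hT' _ hr'
  rw [Real.ball_eq_Ioo] at h h'
  refine ⟨min (r - δ) (r' - δ'), max (r + δ) (r' + δ'), ?_, ?_, ?_⟩
  · simp [hδ]
  · simp [hδ']
  · rintro x ⟨h1, h2⟩
    rw [min_lt_iff] at h1
    rw [lt_max_iff] at h2
    rcases lt_or_ge x r with hxr | hxr <;> rcases lt_or_ge x r' with hxr' | hxr'
    · rcases h1 with h1 | h1
      · exact h ⟨h1, by linarith⟩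
      · exact h' ⟨h1, by linarith⟩
    · exact hT.out hr' hr ⟨hxr', hxr.le⟩
    · exact hT.out hr hr' ⟨hxr, hxr'.le⟩
    · rcases h2 with h2 | h2
      · exact h ⟨by linarith, h2⟩
      · exact h' ⟨by linarith, h2⟩

/-- The flow of a Hamiltonian vector field consists of symplectic maps, wherever it is defined. -/
theorem isSymplecticAt_flow {Ω : ∀ x : M, TangentSpace I x → TangentSpace I x → ℝ}
    {X : ∀ x : M, TangentSpace I x}
    (hX : ContMDiff I I.tangent ∞ (fun x ↦ (⟨x, X x⟩ : TangentBundle I M)))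
    (hΩ : IsLocallyHamiltonian Ω X) {D : Set (ℝ × M)} {F : ℝ → M → M} (hD : IsOpen D)
    (hD0 : ∀ (t : ℝ) (x : M), (t, x) ∈ D → ∀ s ∈ uIcc 0 t, (s, x) ∈ D)
    (hF0 : ∀ x : M, ((0 : ℝ), x) ∈ D → F 0 x = x)
    (hF : ∀ x : M, IsMIntegralCurveOn (I := I) (fun t ↦ F t x) X {t : ℝ | (t, x) ∈ D})
    {n : ℕ} (hn : 1 ≤ n) {t : ℝ} {x : M} (htx : (t, x) ∈ D) : IsSymplecticAt Ω n (F t) x := by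
  have hopen : ∀ y : M, IsOpen {t : ℝ | (t, y) ∈ D} := fun y ↦
    hD.preimage (by fun_prop : Continuous fun t : ℝ ↦ (t, y))
  have hconn : ∀ y : M, {t : ℝ | (t, y) ∈ D}.OrdConnected := fun y ↦
    ordConnected_of_uIcc_zero_subset fun t ht s hs ↦ hD0 t y ht s hs
  have hDx : ∀ {r : ℝ}, (r, x) ∈ D → ∀ᶠ y in 𝓝 x, (r, y) ∈ D := fun {r} hr ↦
    (hD.preimage (by fun_prop : Continuous fun y : M ↦ (r, y))).mem_nhds hr
  have h0 : ((0 : ℝ), x) ∈ D := hD0 t x htx 0 left_mem_uIcc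
  have hX1 : ContMDiff I I.tangent 1 (fun x ↦ (⟨x, X x⟩ : TangentBundle I M)) :=
    hX.of_le (by simp)
  -- The property propagated in time concerns a whole neighbourhood of `x`, which may shrink from
  -- step to step.
  suffices h : (∀ᶠ y in 𝓝 x, IsSymplecticAt Ω n (F 0) y) →
      ∀ᶠ y in 𝓝 x, IsSymplecticAt Ω n (F t) y by
    refine (h ?_).self_of_nhds
    have : ∀ᶠ y in 𝓝 x, F 0 y = id y := (hDx h0).mono fun y hy ↦ hF0 y hy
    exact this.eventually_nhds.mono fun y hy ↦ (isSymplecticAt_id Ω n y).congr hy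
  refine (hconn x).isPreconnected.induction₂'
    (fun r r' ↦ (∀ᶠ y in 𝓝 x, IsSymplecticAt Ω n (F r) y) →
      ∀ᶠ y in 𝓝 x, IsSymplecticAt Ω n (F r') y)
    (fun s hs ↦ ?_) (fun _ _ _ _ _ _ h h' ↦ h' ∘ h) h0 htx
  -- One local flow around `F s x` serves both directions of time: for `r` near `s` the point `F r
  -- x` still lies in `U`.
  obtain ⟨ε, hε, U, hU, hsU, Φ, hΦ⟩ := exists_localFlow hX hΩ n (F s x)
  have step : ∀ r r', (r, x) ∈ D → (r', x) ∈ D → F r x ∈ U → r' - r ∈ Ioo (-ε) ε →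
      (∀ᶠ y in 𝓝 x, IsSymplecticAt Ω n (F r) y) → ∀ᶠ y in 𝓝 x, IsSymplecticAt Ω n (F r') y := by
    intro r r' hr hr' hrU hrr' hS
    -- Continuity of `F r` in the initial value is not part of the notion of flow; it comes from the
    -- property already known at time `r`.
    have hyU : ∀ᶠ y in 𝓝 x, F r y ∈ U :=
      hS.self_of_nhds.contMDiffAt.continuousAt.eventually_mem (hU.mem_nhds hrU)
    -- Both `t ↦ F t y` and `t ↦ Φ (t - r) (F r y)` are integral curves that agree at `t = r`, so
    -- they agree at `r'`.
    have heq : ∀ᶠ y in 𝓝 x, F r' y = (Φ (r' - r) ∘ F r) y := by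
      filter_upwards [hyU, hDx hr, hDx hr'] with y hyU hry hry'
      obtain ⟨a, b, hra, hrb, hab⟩ := (hconn y).exists_Ioo_subset (hopen y) hry hry'
      have h1 : IsMIntegralCurveOn (I := I) (fun t ↦ F t y) X (Ioo (max a (r - ε)) (min b (r + ε))) :=
        (hF y).mono ((Ioo_subset_Ioo (le_max_left _ _) (min_le_left _ _)).trans hab)
      have h2 : IsMIntegralCurveOn (I := I) (fun t ↦ Φ (t - r) (F r y)) X
          (Ioo (max a (r - ε)) (min b (r + ε))) := by
        refine IsMIntegralCurveOn.mono
          ((isMIntegralCurveOn_comp_sub (dt := r)).2 (hΦ _ hyU).2.1) fun t ht ↦ ?_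
        have h1 := (le_max_right _ _).trans_lt ht.1
        have h2 := ht.2.trans_le (min_le_right _ _)
        exact ⟨by linarith, by linarith⟩
      refine isMIntegralCurveOn_Ioo_eqOn_of_contMDiff_boundaryless (t₀ := r) ?_ hX1 h1 h2 ?_ ?_
      · exact ⟨max_lt hra.1 (by linarith), lt_min hra.2 (by linarith)⟩
      · simp [(hΦ _ hyU).1]
      · exact ⟨max_lt hrb.1 (by linarith [hrr'.1]), lt_min hrb.2 (by linarith [hrr'.2])⟩
    filter_upwards [hyU, hS, heq.eventually_nhds] with y hyU hSy hy
    exact (IsSymplecticAt.comp (by exact_mod_cast hn) ((hΦ _ hyU).2.2 _ hrr') hSy).congr hy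
  have hcont : ContinuousAt (fun r ↦ F r x) s :=
    ((hF x).continuousOn).continuousAt ((hopen x).mem_nhds hs)
  have hev : ∀ᶠ r in 𝓝 s, (r, x) ∈ D ∧ F r x ∈ U ∧ r ∈ Ioo (s - ε) (s + ε) :=
    (show ∀ᶠ r in 𝓝 s, (r, x) ∈ D from (hopen x).mem_nhds hs).and ((hcont.eventually_mem (hU.mem_nhds hsU)).and
      (Ioo_mem_nhds (by linarith) (by linarith)))
  refine Filter.Eventually.filter_mono nhdsWithin_le_nhds (hev.mono ?_)
  rintro r ⟨hr, hrU, hrs⟩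
  exact ⟨step s r hs hr hsU ⟨by linarith [hrs.1], by linarith [hrs.2]⟩,
    step r s hr hs hrU ⟨by linarith [hrs.2], by linarith [hrs.1]⟩⟩

end GlobalFlow

namespace WeakPoisson

/-! ### Charts of `TQ` and coordinate criteria for smoothness. -/

section TangentCharts

variable {E : Type*} [NormedAddCommGroup E] [NormedSpace ℝ E]
  {Q : Type*} [TopologicalSpace Q] [ChartedSpace E Q] [IsManifold 𝓘(ℝ, E) ∞ Q]

theorem trivializationAt_snd_eq_chartDeriv {p q : Q} (hq : q ∈ (extChartAt 𝓘(ℝ, E) p).source)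
    (v : TangentSpace 𝓘(ℝ, E) q) :
    (trivializationAt E (TangentSpace 𝓘(ℝ, E)) p ⟨q, v⟩).2 = chartDeriv p q v := by
  have hq' : q ∈ (chartAt E p).source := by simpa using hq
  rw [chartDeriv, ← TangentBundle.continuousLinearMapAt_trivializationAt hq']
  exact (Trivialization.continuousLinearMapAt_apply_of_mem ℝ _ hq' _).symm

theorem extChartAt_tangent_eq_tangentChart {V₀ V : TangentBundle 𝓘(ℝ, E) Q}
    (hV : V.proj ∈ (extChartAt 𝓘(ℝ, E) V₀.proj).source) :
    extChartAt 𝓘(ℝ, E).tangent V₀ V = tangentChart V₀.proj V := by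
  have h1 : (trivializationAt E (TangentSpace 𝓘(ℝ, E)) V₀.proj V).1 = V.proj :=
    Trivialization.coe_fst' _ (by simpa using hV)
  rw [FiberBundle.extChartAt]
  refine Prod.ext ?_ (trivializationAt_snd_eq_chartDeriv hV V.2)
  change extChartAt 𝓘(ℝ, E) V₀.proj (trivializationAt E (TangentSpace 𝓘(ℝ, E)) V₀.proj V).1 = _
  rw [h1]
  rfl

theorem mem_extChartAt_tangent_source {V₀ V : TangentBundle 𝓘(ℝ, E) Q} :
    V ∈ (extChartAt 𝓘(ℝ, E).tangent V₀).source ↔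
      V.proj ∈ (extChartAt 𝓘(ℝ, E) V₀.proj).source := by
  rw [extChartAt_source, TangentBundle.mem_chart_source_iff, extChartAt_source]

theorem eventually_proj_mem_source {p : Q} {V : TangentBundle 𝓘(ℝ, E) Q}
    (hV : V.proj ∈ (extChartAt 𝓘(ℝ, E) p).source) :
    ∀ᶠ W : TangentBundle 𝓘(ℝ, E) Q in 𝓝 V, W.proj ∈ (extChartAt 𝓘(ℝ, E) p).source :=
  (FiberBundle.continuous_proj E (TangentSpace 𝓘(ℝ, E))).continuousAt.eventually_mem
    ((isOpen_extChartAt_source p).mem_nhds hV)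

theorem mfderiv_extChartAt_tangent {V₀ V : TangentBundle 𝓘(ℝ, E) Q}
    (hV : V.proj ∈ (extChartAt 𝓘(ℝ, E) V₀.proj).source)
    (ξ : TangentSpace 𝓘(ℝ, E).tangent V) :
    (mfderiv 𝓘(ℝ, E).tangent 𝓘(ℝ, E × E) (extChartAt 𝓘(ℝ, E).tangent V₀) V ξ : E × E) =
      tangentChartDeriv V₀.proj V ξ := by
  have h : extChartAt 𝓘(ℝ, E).tangent V₀ =ᶠ[𝓝 V] tangentChart V₀.proj :=
    (eventually_proj_mem_source hV).mono fun W hW ↦ extChartAt_tangent_eq_tangentChart hW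
  exact congrArg (fun φ : E × E →L[ℝ] E × E ↦ φ ξ) (h.mfderiv_eq (I := 𝓘(ℝ, E).tangent)
    (I' := 𝓘(ℝ, E × E)))

theorem contMDiffAt_tangentChart {p : Q} {V : TangentBundle 𝓘(ℝ, E) Q}
    (hV : V.proj ∈ (extChartAt 𝓘(ℝ, E) p).source) :
    ContMDiffAt 𝓘(ℝ, E).tangent 𝓘(ℝ, E × E) ∞ (tangentChart p) V := by
  -- The zero vector is an arbitrary choice: on vectors over the chart domain, the chart around `V₀`
  -- depends on `V₀.proj` alone.
  let V₀ : TangentBundle 𝓘(ℝ, E) Q := ⟨p, 0⟩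
  have h : tangentChart p =ᶠ[𝓝 V] extChartAt 𝓘(ℝ, E).tangent V₀ :=
    (eventually_proj_mem_source hV).mono fun W hW ↦
      (extChartAt_tangent_eq_tangentChart (V₀ := V₀) hW).symm
  refine ContMDiffAt.congr_of_eventuallyEq ?_ h
  exact contMDiffAt_extChartAt' (by
    simpa using (mem_extChartAt_tangent_source (V₀ := V₀)).2 hV)

theorem isInvertible_tangentChartDeriv {p : Q} {V : TangentBundle 𝓘(ℝ, E) Q}
    (hV : V.proj ∈ (extChartAt 𝓘(ℝ, E) p).source) :
    (tangentChartDeriv p V).IsInvertible := by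
  let V₀ : TangentBundle 𝓘(ℝ, E) Q := ⟨p, 0⟩
  have h1 := isInvertible_mfderiv_extChartAt (I := 𝓘(ℝ, E).tangent)
    ((mem_extChartAt_tangent_source (V₀ := V₀)).2 hV)
  have h2 : (mfderiv 𝓘(ℝ, E).tangent 𝓘(ℝ, E × E) (extChartAt 𝓘(ℝ, E).tangent V₀) V :
      E × E →L[ℝ] E × E) = tangentChartDeriv p V :=
    ContinuousLinearMap.ext fun ξ ↦ mfderiv_extChartAt_tangent (V₀ := V₀) hV ξ
  obtain ⟨e, he⟩ := h1
  exact ⟨e, he.trans h2⟩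

theorem isInvertible_chartDeriv {p q : Q} (hq : q ∈ (extChartAt 𝓘(ℝ, E) p).source) :
    (chartDeriv p q : TangentSpace 𝓘(ℝ, E) q →L[ℝ] E).IsInvertible :=
  isInvertible_mfderiv_extChartAt hq

/-- Both sides differentiate `W ↦ extChartAt 𝓘(ℝ, E) p W.proj`, once through `τ` and once as the
first component of `tangentChart p`. -/
theorem chartDeriv_projDeriv {p : Q} {V : TangentBundle 𝓘(ℝ, E) Q}
    (hV : V.proj ∈ (extChartAt 𝓘(ℝ, E) p).source) (ξ : TangentSpace 𝓘(ℝ, E).tangent V) :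
    chartDeriv p V.proj (projDeriv V ξ) = (tangentChartDeriv p V ξ).1 := by
  have h1 : HasMFDerivAt 𝓘(ℝ, E).tangent 𝓘(ℝ, E)
      (fun W : TangentBundle 𝓘(ℝ, E) Q ↦ extChartAt 𝓘(ℝ, E) p W.proj) V
      ((chartDeriv p V.proj : E →L[ℝ] E) ∘L (projDeriv V : E × E →L[ℝ] E)) := by
    have a : HasMFDerivAt 𝓘(ℝ, E) 𝓘(ℝ, E) (extChartAt 𝓘(ℝ, E) p) V.proj (chartDeriv p V.proj) :=
      (mdifferentiableAt_extChartAt (by simpa using hV)).hasMFDerivAt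
    have b : HasMFDerivAt 𝓘(ℝ, E).tangent 𝓘(ℝ, E)
        (fun W : TangentBundle 𝓘(ℝ, E) Q ↦ W.proj) V (projDeriv V) :=
      ((contMDiff_proj (n := ∞) (TangentSpace 𝓘(ℝ, E))).mdifferentiableAt (by simp)).hasMFDerivAt
    exact a.comp V b
  have h2 : HasMFDerivAt 𝓘(ℝ, E).tangent 𝓘(ℝ, E)
      (fun W : TangentBundle 𝓘(ℝ, E) Q ↦ (tangentChart p W).1) V
      (ContinuousLinearMap.fst ℝ E E ∘L tangentChartDeriv p V) :=
    (hasFDerivAt_fst (p := tangentChart p V)).hasMFDerivAt.comp V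
      ((contMDiffAt_tangentChart hV).mdifferentiableAt (by simp)).hasMFDerivAt
  exact congrArg (fun φ : E × E →L[ℝ] E ↦ φ ξ) (hasMFDerivAt_unique h1 h2)

/-- A vector field along the projection `TQ → Q` is smooth if its coordinates are. -/
theorem contMDiffAt_mk_proj_iff {Z : (V : TangentBundle 𝓘(ℝ, E) Q) → TangentSpace 𝓘(ℝ, E) V.proj}
    {V₀ : TangentBundle 𝓘(ℝ, E) Q} :
    ContMDiffAt 𝓘(ℝ, E).tangent 𝓘(ℝ, E).tangent ∞
      (fun V ↦ (⟨V.proj, Z V⟩ : TangentBundle 𝓘(ℝ, E) Q)) V₀ ↔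
    ContMDiffAt 𝓘(ℝ, E).tangent 𝓘(ℝ, E) ∞ (fun V ↦ chartDeriv V₀.proj V.proj (Z V)) V₀ := by
  rw [contMDiffAt_totalSpace]
  have h : (fun V : TangentBundle 𝓘(ℝ, E) Q ↦
      (trivializationAt E (TangentSpace 𝓘(ℝ, E)) V₀.proj ⟨V.proj, Z V⟩).2) =ᶠ[𝓝 V₀]
      fun V ↦ chartDeriv V₀.proj V.proj (Z V) :=
    (eventually_proj_mem_source (mem_extChartAt_source _)).mono fun V hV ↦
      trivializationAt_snd_eq_chartDeriv hV _
  refine (and_iff_right ((contMDiff_proj (TangentSpace 𝓘(ℝ, E))).contMDiffAt)).trans ?_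
  exact h.contMDiffAt_iff

/-- A vector field on `TQ` is smooth if its coordinates are. -/
theorem contMDiffAt_mk_iff
    {Y : (V : TangentBundle 𝓘(ℝ, E) Q) → TangentSpace 𝓘(ℝ, E).tangent V}
    {V₀ : TangentBundle 𝓘(ℝ, E) Q} :
    ContMDiffAt 𝓘(ℝ, E).tangent 𝓘(ℝ, E).tangent.tangent ∞
      (fun V ↦ (⟨V, Y V⟩ : TangentBundle 𝓘(ℝ, E).tangent (TangentBundle 𝓘(ℝ, E) Q))) V₀ ↔
    ContMDiffAt 𝓘(ℝ, E).tangent 𝓘(ℝ, E × E) ∞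
      (fun V ↦ tangentChartDeriv V₀.proj V (Y V)) V₀ := by
  rw [contMDiffAt_totalSpace]
  have h : (fun V : TangentBundle 𝓘(ℝ, E) Q ↦
      (trivializationAt (E × E) (TangentSpace 𝓘(ℝ, E).tangent) V₀ ⟨V, Y V⟩).2) =ᶠ[𝓝 V₀]
      fun V ↦ tangentChartDeriv V₀.proj V (Y V) := by
    refine (eventually_proj_mem_source (mem_extChartAt_source V₀.proj)).mono fun V hV ↦ ?_
    have hV' : V ∈ (chartAt (ModelProd E E) V₀).source := by
      simpa using mem_extChartAt_tangent_source.2 hV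
    refine Eq.trans ?_ (mfderiv_extChartAt_tangent hV (Y V))
    rw [← TangentBundle.continuousLinearMapAt_trivializationAt hV']
    exact (Trivialization.continuousLinearMapAt_apply_of_mem ℝ _ hV' _).symm
  refine (and_iff_right contMDiffAt_id).trans ?_
  exact h.contMDiffAt_iff

end TangentCharts

theorem _root_.fderiv_clm_apply_prod {E F : Type*} [NormedAddCommGroup E] [NormedSpace ℝ E]
    [NormedAddCommGroup F] [NormedSpace ℝ F] {f : E → F →L[ℝ] ℝ} {z : E × F}
    (hf : DifferentiableAt ℝ f z.1) (a : E × F) :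
    fderiv ℝ (fun z : E × F ↦ f z.1 z.2) z a =
      fderiv ℝ (fun x ↦ f x z.2) z.1 a.1 + f z.1 a.2 := by
  have h : HasFDerivAt (fun z : E × F ↦ f z.1) (fderiv ℝ f z.1 ∘L ContinuousLinearMap.fst ℝ E F) z :=
    hf.hasFDerivAt.comp z hasFDerivAt_fst
  rw [(h.clm_apply hasFDerivAt_snd).fderiv,
    (hf.hasFDerivAt.clm_apply (hasFDerivAt_const z.2 z.1)).fderiv]
  simp [add_comm]

/-! ### The weak metric in charts. -/

section Metric

variable {E : Type*} [NormedAddCommGroup E] [NormedSpace ℝ E]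
  {Q : Type*} [TopologicalSpace Q] [ChartedSpace E Q] [IsManifold 𝓘(ℝ, E) ∞ Q]

/-- The metric in the chart around `p`, as a field of continuous bilinear forms on `E`. -/
noncomputable def WeakRiemannianMetric.chartBilin (g : WeakRiemannianMetric E Q) (p : Q) (x : E) :
    E →L[ℝ] E →L[ℝ] ℝ :=
  let A : E →L[ℝ] E := mfderiv 𝓘(ℝ, E) 𝓘(ℝ, E) (extChartAt 𝓘(ℝ, E) p).symm x
  let B : E →L[ℝ] E →L[ℝ] ℝ := g.inner ((extChartAt 𝓘(ℝ, E) p).symm x)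
  B.bilinearComp A A

theorem WeakRiemannianMetric.inChart_eq (g : WeakRiemannianMetric E Q) (p : Q) (x a b : E) :
    g.inChart p x a b = g.chartBilin p x a b := rfl

theorem WeakRiemannianMetric.inChart_chartDeriv (g : WeakRiemannianMetric E Q) {p q : Q}
    (hq : q ∈ (extChartAt 𝓘(ℝ, E) p).source) (v w : TangentSpace 𝓘(ℝ, E) q) :
    g.inChart p (extChartAt 𝓘(ℝ, E) p q) (chartDeriv p q v) (chartDeriv p q w) =
      g.inner q v w := by
  -- Stated at points of the form `symm x` so that the base point can afterwards be rewritten in the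
  -- types of `v` and `w`.
  have key : ∀ (x : E), x ∈ (extChartAt 𝓘(ℝ, E) p).target →
      ∀ v w : TangentSpace 𝓘(ℝ, E) ((extChartAt 𝓘(ℝ, E) p).symm x),
      g.inChart p x (chartDeriv p ((extChartAt 𝓘(ℝ, E) p).symm x) v)
        (chartDeriv p ((extChartAt 𝓘(ℝ, E) p).symm x) w) =
      g.inner ((extChartAt 𝓘(ℝ, E) p).symm x) v w := by
    intro x hx v w
    exact congrArg₂ (fun a b ↦ g.inner ((extChartAt 𝓘(ℝ, E) p).symm x) a b)
      (mfderiv_extChartAt_symm_mfderiv_extChartAt hx v)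
      (mfderiv_extChartAt_symm_mfderiv_extChartAt hx w)
  have h := key _ ((extChartAt 𝓘(ℝ, E) p).map_source hq)
  rw [(extChartAt 𝓘(ℝ, E) p).left_inv hq] at h
  exact h v w

set_option synthInstance.maxHeartbeats 400000 in
theorem WeakRiemannianMetric.contDiffOn_chartBilin (g : WeakRiemannianMetric E Q) (p : Q) :
    ContDiffOn ℝ ∞ (g.chartBilin p) (extChartAt 𝓘(ℝ, E) p).target := by
  set e := trivializationAt (E →L[ℝ] E →L[ℝ] ℝ)
    (fun q : Q ↦ TangentSpace 𝓘(ℝ, E) q →L[ℝ] TangentSpace 𝓘(ℝ, E) q →L[ℝ] ℝ) p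
  have hb : (chartAt E p).source ⊆ e.baseSet := by
    intro q hq
    refine ⟨hq, hq, mem_univ _⟩
  have h1 := (e.contMDiffOn_section_iff (chartAt E p).open_source hb).1
    (g.contMDiff.contMDiffOn (s := (chartAt E p).source))
  have hmaps : ∀ y ∈ (extChartAt 𝓘(ℝ, E) p).target, (extChartAt 𝓘(ℝ, E) p).symm y ∈
      (chartAt E p).source := fun y hy ↦ by
    simpa using (extChartAt 𝓘(ℝ, E) p).map_target hy
  have h2 := h1.comp (contMDiffOn_extChartAt_symm (n := ∞) p) hmaps
  rw [contMDiffOn_iff_contDiffOn] at h2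
  refine h2.congr fun y hy ↦ ?_
  -- The inverse trivialization of the tangent bundle is the derivative of the inverse chart, so the
  -- trivialized metric is exactly `chartBilin`.
  have hs := TangentBundle.symmL_trivializationAt (I := 𝓘(ℝ, E)) (hmaps y hy)
  rw [(extChartAt 𝓘(ℝ, E) p).right_inv hy, ModelWithCorners.range_eq_univ, mfderivWithin_univ] at hs
  ext a b
  simp only [Function.comp_apply, e, hom_trivializationAt_apply,
    ContinuousLinearMap.inCoordinates, ContinuousLinearMap.comp_apply]
  have hmem : (extChartAt 𝓘(ℝ, E) p).symm y ∈ (trivializationAt (E →L[ℝ] ℝ)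
      (fun q : Q ↦ TangentSpace 𝓘(ℝ, E) q →L[ℝ] ℝ) p).baseSet := ⟨hmaps y hy, mem_univ _⟩
  rw [hs, Trivialization.continuousLinearMapAt_apply_of_mem ℝ _ hmem, hom_trivializationAt_apply]
  simp only [ContinuousLinearMap.inCoordinates, ContinuousLinearMap.comp_apply]
  rw [hs]
  simp
  rfl

end Metric

/-! ### The symplectic form through the connection and through the canonical one-form. -/

section Connection

variable {E : Type*} [NormedAddCommGroup E] [NormedSpace ℝ E]
  {Q : Type*} [TopologicalSpace Q] [ChartedSpace E Q] [IsManifold 𝓘(ℝ, E) ∞ Q]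
  {g : WeakRiemannianMetric E Q}

/-- The symplectic form in the chart of `TQ` around `p`. -/
noncomputable def WeakRiemannianMetric.chartForm (g : WeakRiemannianMetric E Q) (p : Q)
    (z a b : E × E) : ℝ :=
  g.inChart p z.1 a.1 b.2 - g.inChart p z.1 a.2 b.1
    + fderiv ℝ (fun x ↦ g.inChart p x z.2 a.1) z.1 b.1
    - fderiv ℝ (fun x ↦ g.inChart p x z.2 b.1) z.1 a.1

/-- Metric compatibility expands the two derivative terms of `Ω`. By symmetry of `Γ` the terms `⟨e,
Γ(e₁, e₃)⟩` cancel, and the others complete `e₂` and `e₄` to values of the connector. The result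
does not mention the chart. -/
theorem RiemannianConnection.chartForm_eq (c : RiemannianConnection g) {p : Q}
    {V : TangentBundle 𝓘(ℝ, E) Q} (hV : V.proj ∈ (extChartAt 𝓘(ℝ, E) p).source)
    (ξ ζ : TangentSpace 𝓘(ℝ, E).tangent V) :
    g.chartForm p (tangentChart p V) (tangentChartDeriv p V ξ) (tangentChartDeriv p V ζ) =
      g.inner V.proj (projDeriv V ξ) (c.connector V ζ) -
        g.inner V.proj (c.connector V ξ) (projDeriv V ζ) := by
  have hx : (tangentChart p V).1 ∈ (extChartAt 𝓘(ℝ, E) p).target :=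
    (extChartAt 𝓘(ℝ, E) p).map_source hV
  rw [← g.inChart_chartDeriv hV, ← g.inChart_chartDeriv hV, c.connector_inChart p V hV,
    c.connector_inChart p V hV, chartDeriv_projDeriv hV, chartDeriv_projDeriv hV]
  simp only [WeakRiemannianMetric.chartForm]
  rw [c.christoffel_metric p _ hx, c.christoffel_metric p _ hx,
    c.christoffel_symm p _ hx (tangentChartDeriv p V ζ).1 (tangentChart p V).2,
    c.christoffel_symm p _ hx (tangentChartDeriv p V ξ).1 (tangentChart p V).2,
    c.christoffel_symm p _ hx (tangentChartDeriv p V ζ).1 (tangentChartDeriv p V ξ).1]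
  have hs : ∀ a b, g.inChart p (tangentChart p V).1 a b = g.inChart p (tangentChart p V).1 b a :=
    fun a b ↦ g.symm _ _ _
  have ha : ∀ a b b', g.inChart p (tangentChart p V).1 a (b + b') =
      g.inChart p (tangentChart p V).1 a b + g.inChart p (tangentChart p V).1 a b' :=
    fun a b b' ↦ by simp only [g.inChart_eq, map_add]
  change _ = g.inChart p (tangentChart p V).1 _ _ - g.inChart p (tangentChart p V).1 _ _
  rw [ha, hs (_ + _), ha, hs (tangentChartDeriv p V ζ).1 (tangentChartDeriv p V ξ).2,
    hs (tangentChartDeriv p V ξ).1 (c.christoffel p _ _ _),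
    hs (tangentChartDeriv p V ζ).1 (c.christoffel p _ _ _)]
  ring

theorem RiemannianConnection.symplecticForm_eq (c : RiemannianConnection g)
    (V : TangentBundle 𝓘(ℝ, E) Q) (ξ ζ : TangentSpace 𝓘(ℝ, E).tangent V) :
    g.symplecticForm V ξ ζ = g.inner V.proj (projDeriv V ξ) (c.connector V ζ) -
        g.inner V.proj (c.connector V ξ) (projDeriv V ζ) :=
  c.chartForm_eq (mem_extChartAt_source V.proj) ξ ζ

/-- The canonical one-form of `TQ` in the chart around `p`. -/
noncomputable def WeakRiemannianMetric.chartOneForm (g : WeakRiemannianMetric E Q) (p : Q)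
    (z : E × E) : E × E →L[ℝ] ℝ :=
  g.chartBilin p z.1 z.2 ∘L ContinuousLinearMap.fst ℝ E E

theorem WeakRiemannianMetric.contDiffOn_chartOneForm (g : WeakRiemannianMetric E Q) (p : Q) :
    ContDiffOn ℝ ∞ (g.chartOneForm p) ((extChartAt 𝓘(ℝ, E) p).target ×ˢ univ) :=
  (((g.contDiffOn_chartBilin p).comp contDiffOn_fst fun _ hz ↦ hz.1).clm_apply
    contDiffOn_snd).clm_comp contDiffOn_const

theorem WeakRiemannianMetric.fderiv_chartOneForm (g : WeakRiemannianMetric E Q) (p : Q)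
    {z : E × E} (hz : z.1 ∈ (extChartAt 𝓘(ℝ, E) p).target) (a b : E × E) :
    fderiv ℝ (g.chartOneForm p) z a b =
      fderiv ℝ (fun x ↦ g.inChart p x z.2 b.1) z.1 a.1 + g.inChart p z.1 a.2 b.1 := by
  have h1 : DifferentiableAt ℝ (g.chartOneForm p) z :=
    ((g.contDiffOn_chartOneForm p).contDiffAt (((isOpen_extChartAt_target p).prod
      isOpen_univ).mem_nhds ⟨hz, mem_univ _⟩)).differentiableAt (by simp)
  have h2 : fderiv ℝ (fun z ↦ g.chartOneForm p z b) z a = fderiv ℝ (g.chartOneForm p) z a b := by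
    rw [(h1.hasFDerivAt.clm_apply (hasFDerivAt_const b z)).fderiv]
    simp
  have h3 : ContDiffOn ℝ ∞ (fun x ↦ ContinuousLinearMap.apply ℝ ℝ b.1 ∘L g.chartBilin p x)
      (extChartAt 𝓘(ℝ, E) p).target := contDiffOn_const.clm_comp (g.contDiffOn_chartBilin p)
  rw [← h2]
  exact fderiv_clm_apply_prod
    ((h3.contDiffAt ((isOpen_extChartAt_target p).mem_nhds hz)).differentiableAt (by simp)) a

/-- Makes `Ω` exact in the chart. Only symmetry and smoothness of the metric enter, not the
Christoffel maps. -/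
theorem WeakRiemannianMetric.negExtDeriv_chartOneForm (g : WeakRiemannianMetric E Q) (p : Q)
    {z : E × E} (hz : z.1 ∈ (extChartAt 𝓘(ℝ, E) p).target) (a b : E × E) :
    negExtDeriv (g.chartOneForm p) z a b = g.chartForm p z a b := by
  have hs : g.inChart p z.1 b.2 a.1 = g.inChart p z.1 a.1 b.2 := g.symm _ _ _
  rw [negExtDeriv, g.fderiv_chartOneForm p hz, g.fderiv_chartOneForm p hz, hs, chartForm]
  ring

end Connection

/-! ### The given vector field fits the local Hamiltonian setting. -/

section Hamiltonian

variable {E : Type*} [NormedAddCommGroup E] [NormedSpace ℝ E]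
  {Q : Type*} [TopologicalSpace Q] [ChartedSpace E Q] [IsManifold 𝓘(ℝ, E) ∞ Q]
  {g : WeakRiemannianMetric E Q}

theorem RiemannianConnection.isLocallyHamiltonian (c : RiemannianConnection g)
    {X : (V : TangentBundle 𝓘(ℝ, E) Q) → TangentSpace 𝓘(ℝ, E).tangent V}
    (hX : g.IsSmoothHamiltonian X) :
    IsLocallyHamiltonian (I := 𝓘(ℝ, E).tangent) g.symplecticForm X := by
  obtain ⟨-, H, hH, hXH⟩ := hX
  intro V₀
  set φ := extChartAt 𝓘(ℝ, E).tangent V₀ with hφ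
  have hsrc : ∀ y ∈ φ.target, (φ.symm y).proj ∈ (extChartAt 𝓘(ℝ, E) V₀.proj).source := fun y hy ↦
    mem_extChartAt_tangent_source.1 (φ.map_target hy)
  have hchart : ∀ y ∈ φ.target, tangentChart V₀.proj (φ.symm y) = y := fun y hy ↦ by
    rw [← extChartAt_tangent_eq_tangentChart (hsrc y hy)]
    exact φ.right_inv hy
  have hfst : ∀ y ∈ φ.target, y.1 ∈ (extChartAt 𝓘(ℝ, E) V₀.proj).target := fun y hy ↦ by
    rw [← hchart y hy]
    exact (extChartAt 𝓘(ℝ, E) V₀.proj).map_source (hsrc y hy)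
  refine ⟨φ.target, subset_rfl, isOpen_extChartAt_target V₀, mem_extChartAt_target V₀,
    g.chartOneForm V₀.proj, H ∘ φ.symm, ?_, ?_, ?_⟩
  · exact (g.contDiffOn_chartOneForm V₀.proj).mono fun y hy ↦ ⟨hfst y hy, mem_univ _⟩
  · exact contMDiffOn_iff_contDiffOn.1 (hH.comp_contMDiffOn (contMDiffOn_extChartAt_symm V₀))
  · intro y hy ξ ζ
    constructor
    -- `symplecticForm` uses the chart around the moving point; the chart-free expression transfers
    -- it to the fixed chart around `V₀`.
    · rw [c.symplecticForm_eq, ← c.chartForm_eq (hsrc y hy), hchart y hy,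
        ← g.negExtDeriv_chartOneForm V₀.proj (hfst y hy)]
      exact (congrArg₂ (negExtDeriv (g.chartOneForm V₀.proj) y)
        (mfderiv_extChartAt_tangent (hsrc y hy) ξ) (mfderiv_extChartAt_tangent (hsrc y hy) ζ)).symm
    · rw [hXH]
      have h1 : HasMFDerivAt 𝓘(ℝ, E × E) 𝓘(ℝ, ℝ) (H ∘ φ.symm) y
          ((mfderiv 𝓘(ℝ, E).tangent 𝓘(ℝ, ℝ) H (φ.symm y) : E × E →L[ℝ] ℝ) ∘L
            (mfderiv 𝓘(ℝ, E × E) 𝓘(ℝ, E).tangent φ.symm y : E × E →L[ℝ] E × E)) :=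
        (hH.mdifferentiableAt (by simp)).hasMFDerivAt.comp y (hasMFDerivAt_extChartAt_symm hy)
      have h2 := congrArg
        (fun v : E × E ↦ (mfderiv 𝓘(ℝ, E).tangent 𝓘(ℝ, ℝ) H (φ.symm y) : E × E →L[ℝ] ℝ) v)
        (mfderiv_extChartAt_symm_mfderiv_extChartAt hy ζ)
      have h3 : fderiv ℝ (H ∘ φ.symm) y =
          (mfderiv 𝓘(ℝ, E).tangent 𝓘(ℝ, ℝ) H (φ.symm y) : E × E →L[ℝ] ℝ) ∘L
            (mfderiv 𝓘(ℝ, E × E) 𝓘(ℝ, E).tangent φ.symm y : E × E →L[ℝ] E × E) :=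
        HasFDerivAt.fderiv (hasMFDerivAt_iff_hasFDerivAt.1 h1)
      rw [h3]
      exact h2.symm

end Hamiltonian

/-! ### Class `𝒦` and Hamiltonian vector fields. -/

section ClassK

variable {E : Type*} [NormedAddCommGroup E] [NormedSpace ℝ E]
  {Q : Type*} [TopologicalSpace Q] [ChartedSpace E Q] [IsManifold 𝓘(ℝ, E) ∞ Q]
  {g : WeakRiemannianMetric E Q}

/-- In a chart `Θ` is the shear `(u, w) ↦ (u, w + Γ(v, u))`. This ensures that `(c.theta V).inverse`
is a true inverse and not the default value `0`. -/
theorem RiemannianConnection.isInvertible_theta (c : RiemannianConnection g)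
    (V : TangentBundle 𝓘(ℝ, E) Q) : (c.theta V).IsInvertible := by
  have hV := mem_extChartAt_source (I := 𝓘(ℝ, E)) V.proj
  obtain ⟨e, he⟩ := isInvertible_chartDeriv hV
  obtain ⟨t, ht⟩ := isInvertible_tangentChartDeriv hV
  let S : (E × E) ≃L[ℝ] (E × E) := (ContinuousLinearEquiv.refl ℝ E).skewProd
    (ContinuousLinearEquiv.refl ℝ E)
    (c.christoffel V.proj (tangentChart V.proj V).1 (tangentChart V.proj V).2)
  refine ⟨(t.trans S).trans (e.prodCongr e).symm, ContinuousLinearMap.ext fun ξ ↦ ?_⟩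
  have h1 : ∀ v, e v = chartDeriv V.proj V.proj v := fun v ↦ congrArg (fun φ ↦ φ v) he
  have h2 : ∀ v, t v = tangentChartDeriv V.proj V v := fun v ↦ congrArg (fun φ ↦ φ v) ht
  apply (e.prodCongr e).injective
  refine ((e.prodCongr e).apply_symm_apply _).trans ?_
  refine Prod.ext ?_ ?_
  · refine Eq.trans ?_ (h1 _).symm
    refine Eq.trans ?_ (chartDeriv_projDeriv hV ξ).symm
    rw [← h2 ξ]
    rfl
  · refine Eq.trans ?_ (h1 _).symm
    refine Eq.trans ?_ (c.connector_inChart _ V hV ξ).symm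
    rw [← h2 ξ]
    rfl

theorem RiemannianConnection.theta_inverse (c : RiemannianConnection g)
    {V : TangentBundle 𝓘(ℝ, E) Q} (w : TangentSpace 𝓘(ℝ, E) V.proj × TangentSpace 𝓘(ℝ, E) V.proj) :
    c.theta V ((c.theta V).inverse w) = w :=
  (c.isInvertible_theta V).self_apply_inverse w

theorem RiemannianConnection.inverse_theta (c : RiemannianConnection g)
    {V : TangentBundle 𝓘(ℝ, E) Q} (ξ : TangentSpace 𝓘(ℝ, E).tangent V) :
    (c.theta V).inverse (c.theta V ξ) = ξ :=
  (c.isInvertible_theta V).inverse_apply_self ξ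

theorem RiemannianConnection.projDeriv_inverse (c : RiemannianConnection g)
    {V : TangentBundle 𝓘(ℝ, E) Q} (w : TangentSpace 𝓘(ℝ, E) V.proj × TangentSpace 𝓘(ℝ, E) V.proj) :
    projDeriv V ((c.theta V).inverse w) = w.1 := congrArg Prod.fst (c.theta_inverse w)

theorem RiemannianConnection.connector_inverse (c : RiemannianConnection g)
    {V : TangentBundle 𝓘(ℝ, E) Q} (w : TangentSpace 𝓘(ℝ, E) V.proj × TangentSpace 𝓘(ℝ, E) V.proj) :
    c.connector V ((c.theta V).inverse w) = w.2 := congrArg Prod.snd (c.theta_inverse w)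

theorem WeakRiemannianMetric.represents_representative {q : Q} {φ : TangentSpace 𝓘(ℝ, E) q → ℝ}
    (h : ∃ Z, g.Represents q φ Z) : g.Represents q φ (g.representative q φ) := by
  rw [representative, dif_pos h]
  exact h.choose_spec

/-- Uniqueness: the difference of two representing vectors is orthogonal to itself, so it vanishes
by positive definiteness. -/
theorem WeakRiemannianMetric.representative_eq {q : Q} {φ : TangentSpace 𝓘(ℝ, E) q → ℝ}
    {Z : TangentSpace 𝓘(ℝ, E) q} (h : g.Represents q φ Z) : g.representative q φ = Z := by
  have h' := g.represents_representative ⟨Z, h⟩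
  by_contra hne
  have hpos := g.pos q _ (sub_ne_zero.2 hne)
  have : g.inner q (g.representative q φ - Z) (g.representative q φ - Z) = 0 := by
    rw [map_sub (g.inner q), _root_.sub_apply, ← h', ← h, sub_self]
  exact hpos.ne' this

/-- `Y` is a Hamiltonian vector of the function `f` at `V`. -/
def WeakRiemannianMetric.IsHamiltonianVector (g : WeakRiemannianMetric E Q)
    (f : TangentBundle 𝓘(ℝ, E) Q → ℝ) (V : TangentBundle 𝓘(ℝ, E) Q)
    (Y : TangentSpace 𝓘(ℝ, E).tangent V) : Prop :=
  ∀ ζ, g.symplecticForm V Y ζ = mfderiv 𝓘(ℝ, E).tangent 𝓘(ℝ, ℝ) f V ζ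

section HamiltonianVector

variable {f h : TangentBundle 𝓘(ℝ, E) Q → ℝ} {V : TangentBundle 𝓘(ℝ, E) Q}
  {Y Y' : TangentSpace 𝓘(ℝ, E).tangent V}

/-- Pairing `Y` with the horizontal vector `Θ⁻¹(W, 0)` leaves only the term with `K Y`. Vertical
vectors give `Tτ Y` in the next lemma. -/
theorem WeakRiemannianMetric.IsHamiltonianVector.represents_base
    (hY : g.IsHamiltonianVector f V Y) (c : RiemannianConnection g) :
    g.Represents V.proj (c.partialBase f V) (-c.connector V Y) := by
  intro W
  rw [RiemannianConnection.partialBase, ← hY, c.symplecticForm_eq, c.projDeriv_inverse,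
    c.connector_inverse]
  simp

theorem WeakRiemannianMetric.IsHamiltonianVector.represents_fiber
    (hY : g.IsHamiltonianVector f V Y) (c : RiemannianConnection g) :
    g.Represents V.proj (c.partialFiber f V) (projDeriv V Y) := by
  intro W
  rw [RiemannianConnection.partialFiber, ← hY, c.symplecticForm_eq, c.projDeriv_inverse,
    c.connector_inverse]
  simp

theorem WeakRiemannianMetric.IsHamiltonianVector.gradBase_eq
    (hY : g.IsHamiltonianVector f V Y) (c : RiemannianConnection g) :
    c.gradBase f V = -c.connector V Y := g.representative_eq (hY.represents_base c)

theorem WeakRiemannianMetric.IsHamiltonianVector.gradFiber_eq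
    (hY : g.IsHamiltonianVector f V Y) (c : RiemannianConnection g) :
    c.gradFiber f V = projDeriv V Y := g.representative_eq (hY.represents_fiber c)

/-- The bracket of two functions is the symplectic product of their Hamiltonian vectors. -/
theorem WeakRiemannianMetric.IsHamiltonianVector.bracket_eq
    (hY : g.IsHamiltonianVector f V Y) (hY' : g.IsHamiltonianVector h V Y')
    (c : RiemannianConnection g) : c.bracket f h V = g.symplecticForm V Y Y' := by
  rw [RiemannianConnection.bracket, hY.gradBase_eq c, hY.gradFiber_eq c, hY'.gradBase_eq c,
    hY'.gradFiber_eq c, c.symplecticForm_eq]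
  simp only [map_neg, _root_.neg_apply]
  ring

end HamiltonianVector

/-- The Hamiltonian vector field of a function of class `𝒦`. -/
noncomputable def RiemannianConnection.hamiltonianField (c : RiemannianConnection g)
    (f : TangentBundle 𝓘(ℝ, E) Q → ℝ) (V : TangentBundle 𝓘(ℝ, E) Q) :
    TangentSpace 𝓘(ℝ, E).tangent V :=
  (c.theta V).inverse (c.gradFiber f V, -c.gradBase f V)

/-- Each tangent vector of `TQ` is the sum of its horizontal and vertical parts, and on these `df`
is given by the two gradients. -/
theorem RiemannianConnection.IsClassK.isHamiltonianVector {c : RiemannianConnection g}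
    {U : Set (TangentBundle 𝓘(ℝ, E) Q)} {f : TangentBundle 𝓘(ℝ, E) Q → ℝ} (hf : c.IsClassK U f)
    {V : TangentBundle 𝓘(ℝ, E) Q} (hV : V ∈ U) :
    g.IsHamiltonianVector f V (c.hamiltonianField f V) := by
  intro ζ
  have hb := g.represents_representative (hf.exists_base V hV) (projDeriv V ζ)
  have hc := g.represents_representative (hf.exists_fiber V hV) (c.connector V ζ)
  have hζ : ζ = (c.theta V).inverse (projDeriv V ζ, 0) +
      (c.theta V).inverse (0, c.connector V ζ) := by
    rw [← map_add]
    refine (c.inverse_theta ζ).symm.trans (congrArg _ ?_)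
    simp [theta]
  have hd : mfderiv 𝓘(ℝ, E).tangent 𝓘(ℝ, ℝ) f V ζ =
      c.partialBase f V (projDeriv V ζ) + c.partialFiber f V (c.connector V ζ) := by
    conv_lhs => rw [hζ]
    exact map_add _ _ _
  rw [hd, hb, hc, c.symplecticForm_eq, hamiltonianField, c.projDeriv_inverse, c.connector_inverse]
  simp [gradBase, gradFiber, add_comm]

theorem contMDiffAt_christoffel (c : RiemannianConnection g) (V₀ : TangentBundle 𝓘(ℝ, E) Q) :
    ContMDiffAt 𝓘(ℝ, E).tangent 𝓘(ℝ, E →L[ℝ] E) ∞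
      (fun V ↦ c.christoffel V₀.proj (tangentChart V₀.proj V).1 (tangentChart V₀.proj V).2) V₀ := by
  have h1 := contMDiffAt_tangentChart (mem_extChartAt_source (I := 𝓘(ℝ, E)) V₀.proj)
  have h2 : ContDiffAt ℝ ∞ (fun z : E × E ↦ c.christoffel V₀.proj z.1 z.2)
      (tangentChart V₀.proj V₀) := by
    refine ContDiffAt.clm_apply (ContDiffAt.comp (g := c.christoffel V₀.proj) _ ?_ contDiffAt_fst)
      contDiffAt_snd
    exact (c.contDiffOn_christoffel V₀.proj).contDiffAt
      (extChartAt_target_mem_nhds (I := 𝓘(ℝ, E)) V₀.proj)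
  exact h2.contMDiffAt.comp V₀ h1

theorem RiemannianConnection.contMDiffAt_connector (c : RiemannianConnection g)
    {Y : (V : TangentBundle 𝓘(ℝ, E) Q) → TangentSpace 𝓘(ℝ, E).tangent V}
    {V₀ : TangentBundle 𝓘(ℝ, E) Q}
    (hY : ContMDiffAt 𝓘(ℝ, E).tangent 𝓘(ℝ, E).tangent.tangent ∞
      (fun V ↦ (⟨V, Y V⟩ : TangentBundle 𝓘(ℝ, E).tangent (TangentBundle 𝓘(ℝ, E) Q))) V₀) :
    ContMDiffAt 𝓘(ℝ, E).tangent 𝓘(ℝ, E).tangent ∞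
      (fun V ↦ (⟨V.proj, c.connector V (Y V)⟩ : TangentBundle 𝓘(ℝ, E) Q)) V₀ := by
  rw [contMDiffAt_mk_iff] at hY
  rw [contMDiffAt_mk_proj_iff]
  have h1 : ContMDiffAt 𝓘(ℝ, E).tangent 𝓘(ℝ, E) ∞
      (fun V ↦ (tangentChartDeriv V₀.proj V (Y V)).1) V₀ :=
    contDiff_fst.contMDiff.contMDiffAt.comp V₀ hY
  have h2 : ContMDiffAt 𝓘(ℝ, E).tangent 𝓘(ℝ, E) ∞
      (fun V ↦ (tangentChartDeriv V₀.proj V (Y V)).2) V₀ :=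
    contDiff_snd.contMDiff.contMDiffAt.comp V₀ hY
  refine (h2.add ((contMDiffAt_christoffel c V₀).clm_apply h1)).congr_of_eventuallyEq ?_
  exact (eventually_proj_mem_source (mem_extChartAt_source V₀.proj)).mono fun V hV ↦
    c.connector_inChart V₀.proj V hV (Y V)

theorem contMDiffAt_projDeriv
    {Y : (V : TangentBundle 𝓘(ℝ, E) Q) → TangentSpace 𝓘(ℝ, E).tangent V}
    {V₀ : TangentBundle 𝓘(ℝ, E) Q}
    (hY : ContMDiffAt 𝓘(ℝ, E).tangent 𝓘(ℝ, E).tangent.tangent ∞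
      (fun V ↦ (⟨V, Y V⟩ : TangentBundle 𝓘(ℝ, E).tangent (TangentBundle 𝓘(ℝ, E) Q))) V₀) :
    ContMDiffAt 𝓘(ℝ, E).tangent 𝓘(ℝ, E).tangent ∞
      (fun V ↦ (⟨V.proj, projDeriv V (Y V)⟩ : TangentBundle 𝓘(ℝ, E) Q)) V₀ := by
  rw [contMDiffAt_mk_iff] at hY
  rw [contMDiffAt_mk_proj_iff]
  refine ContMDiffAt.congr_of_eventuallyEq (contDiff_fst.contMDiff.contMDiffAt.comp V₀ hY) ?_
  exact (eventually_proj_mem_source (mem_extChartAt_source V₀.proj)).mono fun V hV ↦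
    chartDeriv_projDeriv hV (Y V)

/-- Inverting the shear, the coordinates are `(A, B - Γ(v, A))`, which are smooth. -/
theorem RiemannianConnection.contMDiffAt_theta_inverse (c : RiemannianConnection g)
    {A B : (V : TangentBundle 𝓘(ℝ, E) Q) → TangentSpace 𝓘(ℝ, E) V.proj}
    {V₀ : TangentBundle 𝓘(ℝ, E) Q}
    (hA : ContMDiffAt 𝓘(ℝ, E).tangent 𝓘(ℝ, E).tangent ∞
      (fun V ↦ (⟨V.proj, A V⟩ : TangentBundle 𝓘(ℝ, E) Q)) V₀)
    (hB : ContMDiffAt 𝓘(ℝ, E).tangent 𝓘(ℝ, E).tangent ∞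
      (fun V ↦ (⟨V.proj, B V⟩ : TangentBundle 𝓘(ℝ, E) Q)) V₀) :
    ContMDiffAt 𝓘(ℝ, E).tangent 𝓘(ℝ, E).tangent.tangent ∞
      (fun V ↦ (⟨V, (c.theta V).inverse (A V, B V)⟩ :
        TangentBundle 𝓘(ℝ, E).tangent (TangentBundle 𝓘(ℝ, E) Q))) V₀ := by
  rw [contMDiffAt_mk_proj_iff] at hA hB
  rw [contMDiffAt_mk_iff]
  have h := hA.prodMk_space (hB.sub ((contMDiffAt_christoffel c V₀).clm_apply hA))
  refine h.congr_of_eventuallyEq ?_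
  refine (eventually_proj_mem_source (mem_extChartAt_source V₀.proj)).mono fun V hV ↦ ?_
  have h1 := chartDeriv_projDeriv hV ((c.theta V).inverse (A V, B V))
  have h2 := c.connector_inChart V₀.proj V hV ((c.theta V).inverse (A V, B V))
  rw [c.projDeriv_inverse] at h1
  rw [c.connector_inverse, ← h1] at h2
  refine Prod.ext h1.symm ?_
  exact eq_sub_of_add_eq h2.symm

theorem contMDiffAt_neg_mk {A : (V : TangentBundle 𝓘(ℝ, E) Q) → TangentSpace 𝓘(ℝ, E) V.proj}
    {V₀ : TangentBundle 𝓘(ℝ, E) Q}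
    (hA : ContMDiffAt 𝓘(ℝ, E).tangent 𝓘(ℝ, E).tangent ∞
      (fun V ↦ (⟨V.proj, A V⟩ : TangentBundle 𝓘(ℝ, E) Q)) V₀) :
    ContMDiffAt 𝓘(ℝ, E).tangent 𝓘(ℝ, E).tangent ∞
      (fun V ↦ (⟨V.proj, -A V⟩ : TangentBundle 𝓘(ℝ, E) Q)) V₀ := by
  rw [contMDiffAt_mk_proj_iff] at hA ⊢
  simp only [map_neg]
  exact hA.neg

/-- A function of class `𝒦` has a smooth Hamiltonian vector field. -/
theorem RiemannianConnection.IsClassK.contMDiffAt_hamiltonianField {c : RiemannianConnection g}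
    {U : Set (TangentBundle 𝓘(ℝ, E) Q)} (hU : IsOpen U) {f : TangentBundle 𝓘(ℝ, E) Q → ℝ}
    (hf : c.IsClassK U f) {V₀ : TangentBundle 𝓘(ℝ, E) Q} (hV : V₀ ∈ U) :
    ContMDiffAt 𝓘(ℝ, E).tangent 𝓘(ℝ, E).tangent.tangent ∞
      (fun V ↦ (⟨V, c.hamiltonianField f V⟩ :
        TangentBundle 𝓘(ℝ, E).tangent (TangentBundle 𝓘(ℝ, E) Q))) V₀ :=
  c.contMDiffAt_theta_inverse (hf.smooth_fiber.contMDiffAt (hU.mem_nhds hV))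
    (contMDiffAt_neg_mk (hf.smooth_base.contMDiffAt (hU.mem_nhds hV)))

/-- A smooth function with a smooth Hamiltonian vector field is of class `𝒦`. -/
theorem RiemannianConnection.isClassK_of_isHamiltonianVector (c : RiemannianConnection g)
    {U : Set (TangentBundle 𝓘(ℝ, E) Q)} (hU : IsOpen U) {f : TangentBundle 𝓘(ℝ, E) Q → ℝ}
    {Y : (V : TangentBundle 𝓘(ℝ, E) Q) → TangentSpace 𝓘(ℝ, E).tangent V}
    (hf : ContMDiffOn 𝓘(ℝ, E).tangent 𝓘(ℝ, ℝ) ∞ f U)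
    (hfY : ∀ V ∈ U, g.IsHamiltonianVector f V (Y V))
    (hY : ∀ V ∈ U, ContMDiffAt 𝓘(ℝ, E).tangent 𝓘(ℝ, E).tangent.tangent ∞
      (fun V ↦ (⟨V, Y V⟩ : TangentBundle 𝓘(ℝ, E).tangent (TangentBundle 𝓘(ℝ, E) Q))) V) :
    c.IsClassK U f where
  smooth := hf
  exists_base V hV := ⟨_, (hfY V hV).represents_base c⟩
  exists_fiber V hV := ⟨_, (hfY V hV).represents_fiber c⟩
  smooth_base V hV := by
    refine (ContMDiffAt.congr_of_eventuallyEq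
      (contMDiffAt_neg_mk (c.contMDiffAt_connector (hY V hV))) ?_).contMDiffWithinAt
    filter_upwards [hU.mem_nhds hV] with W hW
    rw [(hfY W hW).gradBase_eq c]
  smooth_fiber V hV := by
    refine (ContMDiffAt.congr_of_eventuallyEq
      (contMDiffAt_projDeriv (hY V hV)) ?_).contMDiffWithinAt
    filter_upwards [hU.mem_nhds hV] with W hW
    rw [(hfY W hW).gradFiber_eq c]

/-- Needed for uniqueness of integral curves in `TQ`. Vectors over different points are separated in
`Q`, vectors over the same point in the fibre of a trivialization. -/
theorem t2Space_tangentBundle [T2Space Q] : T2Space (TangentBundle 𝓘(ℝ, E) Q) := by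
  refine ⟨fun V W hVW ↦ ?_⟩
  have hπ := FiberBundle.continuous_proj E (TangentSpace 𝓘(ℝ, E) (M := Q))
  by_cases hp : V.proj = W.proj
  · set e := trivializationAt E (TangentSpace 𝓘(ℝ, E)) V.proj
    have hV : V ∈ e.source := by rw [e.mem_source]; exact mem_baseSet_trivializationAt _ _ _
    have hW : W ∈ e.source := by rw [e.mem_source, ← hp]; exact mem_baseSet_trivializationAt _ _ _
    have hne : e V ≠ e W := fun h ↦ hVW (e.injOn hV hW h)
    have hne2 : (e V).2 ≠ (e W).2 := fun h ↦ hne (Prod.ext (by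
      rw [e.coe_fst hV, e.coe_fst hW, hp]) h)
    obtain ⟨u, v, hu, hv, hVu, hWv, huv⟩ := t2_separation hne2
    have hc : ContinuousOn (fun Z ↦ (e Z).2) e.source := continuous_snd.comp_continuousOn e.continuousOn
    refine ⟨_, _, hc.isOpen_inter_preimage e.open_source hu,
      hc.isOpen_inter_preimage e.open_source hv, ⟨hV, hVu⟩, ⟨hW, hWv⟩, ?_⟩
    exact Disjoint.mono inter_subset_right inter_subset_right (huv.preimage _)
  · obtain ⟨u, v, hu, hv, hVu, hWv, huv⟩ := t2_separation hp
    exact ⟨_, _, hu.preimage hπ, hv.preimage hπ, hVu, hWv, huv.preimage _⟩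

end ClassK

/-! ### Flow maps are symplectic and preserve class `𝒦`. -/

section Main

universe u

variable {E : Type u} [NormedAddCommGroup E] [NormedSpace ℝ E] [CompleteSpace E]
  {Q : Type*} [TopologicalSpace Q] [T2Space Q] [ChartedSpace E Q] [IsManifold 𝓘(ℝ, E) ∞ Q]
  {g : WeakRiemannianMetric E Q}

/-- The short-time flows depend on the order `n`, but the conclusion at `(t, V)` holds for each `n`,
so `F t` is smooth there. -/
theorem IsLocalFlow.isSymplecticAt (c : RiemannianConnection g)
    {X : (V : TangentBundle 𝓘(ℝ, E) Q) → TangentSpace 𝓘(ℝ, E).tangent V}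
    (hX : g.IsSmoothHamiltonian X) {D : Set (ℝ × TangentBundle 𝓘(ℝ, E) Q)}
    {F : ℝ → TangentBundle 𝓘(ℝ, E) Q → TangentBundle 𝓘(ℝ, E) Q}
    (hF : IsLocalFlow X D F) {t : ℝ} {V : TangentBundle 𝓘(ℝ, E) Q} (hV : (t, V) ∈ D) :
    IsSymplecticAt (I := 𝓘(ℝ, E).tangent) g.symplecticForm ⊤ (F t) V := by
  have := t2Space_tangentBundle (E := E) (Q := Q)
  have h : ∀ n : ℕ, 1 ≤ n → IsSymplecticAt (I := 𝓘(ℝ, E).tangent) g.symplecticForm n (F t) V :=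
    fun n hn ↦ isSymplecticAt_flow hX.1 (c.isLocallyHamiltonian hX) hF.isOpen hF.uIcc_mem
      hF.map_zero hF.integralCurve hn hV
  refine ⟨?_, (h 1 le_rfl).isInvertible, (h 1 le_rfl).map_form⟩
  refine contMDiffAt_infty.2 fun n ↦ ?_
  exact (h (n + 1) (by omega)).contMDiffAt.of_le (by simp)

omit [CompleteSpace E] [T2Space Q] in
/-- The pull-back of the Hamiltonian vector field of a function by a symplectic map is the
Hamiltonian vector field of the composition. -/
theorem isHamiltonianVector_comp
    {φ : TangentBundle 𝓘(ℝ, E) Q → TangentBundle 𝓘(ℝ, E) Q} {V : TangentBundle 𝓘(ℝ, E) Q}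
    (hφ : IsSymplecticAt (I := 𝓘(ℝ, E).tangent) g.symplecticForm ⊤ φ V)
    {f : TangentBundle 𝓘(ℝ, E) Q → ℝ}
    (hf : ContMDiffAt 𝓘(ℝ, E).tangent 𝓘(ℝ, ℝ) ∞ f (φ V))
    {Y : (V : TangentBundle 𝓘(ℝ, E) Q) → TangentSpace 𝓘(ℝ, E).tangent V}
    (hY : g.IsHamiltonianVector f (φ V) (Y (φ V))) :
    g.IsHamiltonianVector (f ∘ φ) V
      (VectorField.mpullback 𝓘(ℝ, E).tangent 𝓘(ℝ, E).tangent φ Y V) := by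
  intro ζ
  have h1 : mfderiv 𝓘(ℝ, E).tangent 𝓘(ℝ, E).tangent φ V
      (VectorField.mpullback 𝓘(ℝ, E).tangent 𝓘(ℝ, E).tangent φ Y V) = Y (φ V) :=
    hφ.isInvertible.self_apply_inverse _
  -- `d(f ∘ φ) ζ = Ω(Y, Tφ ζ)`, and `Y` is the image under `Tφ` of its pull-back, so invariance of
  -- `Ω` removes `Tφ`.
  rw [mfderiv_comp V (hf.mdifferentiableAt (by simp))
    (hφ.contMDiffAt.mdifferentiableAt (by simp)), ← hφ.map_form, h1]
  exact hY _

theorem RiemannianConnection.IsClassK.comp_flow {c : RiemannianConnection g}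
    {X : (V : TangentBundle 𝓘(ℝ, E) Q) → TangentSpace 𝓘(ℝ, E).tangent V}
    (hX : g.IsSmoothHamiltonian X) {D : Set (ℝ × TangentBundle 𝓘(ℝ, E) Q)}
    {F : ℝ → TangentBundle 𝓘(ℝ, E) Q → TangentBundle 𝓘(ℝ, E) Q}
    (hF : IsLocalFlow X D F) (t : ℝ) {f : TangentBundle 𝓘(ℝ, E) Q → ℝ}
    (hf : c.IsClassK univ f) : c.IsClassK {V | (t, V) ∈ D} (f ∘ F t) := by
  have hsymp := fun V (hV : (t, V) ∈ D) ↦ hF.isSymplecticAt c hX hV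
  have hf' : ∀ V, ContMDiffAt 𝓘(ℝ, E).tangent 𝓘(ℝ, ℝ) ∞ f V := fun V ↦
    hf.smooth.contMDiffAt Filter.univ_mem
  refine c.isClassK_of_isHamiltonianVector
    (hF.isOpen.preimage (by fun_prop : Continuous fun V : TangentBundle 𝓘(ℝ, E) Q ↦ (t, V)))
    (Y := VectorField.mpullback 𝓘(ℝ, E).tangent 𝓘(ℝ, E).tangent (F t) (c.hamiltonianField f))
    (fun V hV ↦ ((hf' _).comp V (hsymp V hV).contMDiffAt).contMDiffWithinAt)
    (fun V hV ↦ isHamiltonianVector_comp (hsymp V hV) (hf' _)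
      (hf.isHamiltonianVector (mem_univ _))) fun V hV ↦ ?_
  exact ContMDiffAt.mpullback_vectorField_preimage
    (hf.contMDiffAt_hamiltonianField isOpen_univ (mem_univ _)) (hsymp V hV).contMDiffAt
    (hsymp V hV).isInvertible (by simp)

end Main

end WeakPoisson

theorem mainTheorem10 {E : Type*} [NormedAddCommGroup E] [NormedSpace ℝ E] [CompleteSpace E]
    {Q : Type*} [TopologicalSpace Q] [T2Space Q] [ChartedSpace E Q] [IsManifold 𝓘(ℝ, E) ∞ Q]
    (g : WeakPoisson.WeakRiemannianMetric E Q) (c : WeakPoisson.RiemannianConnection g)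
    (X : (V : TangentBundle 𝓘(ℝ, E) Q) → TangentSpace 𝓘(ℝ, E).tangent V)
    (hX : g.IsSmoothHamiltonian X)
    (D : Set (ℝ × TangentBundle 𝓘(ℝ, E) Q))
    (F : ℝ → TangentBundle 𝓘(ℝ, E) Q → TangentBundle 𝓘(ℝ, E) Q)
    (hF : WeakPoisson.IsLocalFlow X D F) (t : ℝ)
    (f h : TangentBundle 𝓘(ℝ, E) Q → ℝ) (hf : c.IsClassK univ f) (hh : c.IsClassK univ h) :
    c.IsClassK {V | (t, V) ∈ D} (f ∘ F t) ∧ c.IsClassK {V | (t, V) ∈ D} (h ∘ F t) ∧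
      ∀ V : TangentBundle 𝓘(ℝ, E) Q, (t, V) ∈ D →
        c.bracket (f ∘ F t) (h ∘ F t) V = c.bracket f h (F t V) := by
  refine ⟨hf.comp_flow hX hF t, hh.comp_flow hX hF t, fun V hV ↦ ?_⟩
  have hs := hF.isSymplecticAt c hX hV
  have hYf := hf.isHamiltonianVector (mem_univ (F t V))
  have hYh := hh.isHamiltonianVector (mem_univ (F t V))
  have hf' := WeakPoisson.isHamiltonianVector_comp hs
    (hf.smooth.contMDiffAt Filter.univ_mem) hYf
  have hh' := WeakPoisson.isHamiltonianVector_comp hs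
    (hh.smooth.contMDiffAt Filter.univ_mem) hYh
  have hpull : ∀ Y : (V : TangentBundle 𝓘(ℝ, E) Q) → TangentSpace 𝓘(ℝ, E).tangent V,
      mfderiv 𝓘(ℝ, E).tangent 𝓘(ℝ, E).tangent (F t) V
        (VectorField.mpullback 𝓘(ℝ, E).tangent 𝓘(ℝ, E).tangent (F t) Y V) = Y (F t V) :=
    fun Y ↦ hs.isInvertible.self_apply_inverse _
  -- Both brackets are values of `Ω` on Hamiltonian vectors, and the derivative of `F t` maps the
  -- pulled-back pair to the original one.
  rw [hf'.bracket_eq hh' c, hYf.bracket_eq hYh c, ← hs.map_form, hpull, hpull]
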